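/- Let $n,m\ge 1$ be integers, let $\mathbb H=\{z=(x,t): x\in\mathbb R^n,\ t>0\}\subset\mathbb R^{n+1}$, and for $\lambda\in\mathbb R$ put $dm_\lambda(z)=t^\lambda\,dx\,dt$. For $w=(y,s)\in\mathbb H$ let $Q_w$ be the closed cube with sides parallel to the coordinate axes, centre $w$ and side length $s$. Let $\{\Delta_k\}_{k\ge 1}$ be a Whitney decomposition of $\mathbb H$: closed cubes of positive side length with sides parallel to the coordinate axes such that - $\bigcup_k\Delta_k=\mathbb H$, and there are constants $a,b>0$ with $a\,\operatorname{diam}\Delta_k\le\operatorname{dist}(\Delta_k,\partial\mathbb H)\le b\,\operatorname{diam}\Delta_k$ for all $k$; - the interiors of the cubes $\Delta_k$ are pairwise disjoint; - the cubes $\Delta_k^\ast$ with the same centres as $\Delta_k$, enlarged $5/4$ times, are contained in $\mathbb H$, and there is a constant $N$ such that every point lies in at most $N$ of them. Denote the centre of $\Delta_k$ by $\zeta_k=(\xi_k,\eta_k)$, so that $\eta_k>0$ is its height. **Theorem.** Let $0<p_i<\infty$, $0<\sigma_i<\infty$ and $-1<\alpha_i<\infty$ for $i=1,\dots,m$, and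 let $\mu$ be a positive Borel measure on $\mathbb H$. Then the following two conditions are equivalent. 1. There is a finite constant $C$ such that for every $m$-tuple $(f_1,\dots,f_m)$ of (real- or complex-valued) harmonic functions on $\mathbb H$ $$\int_{\mathbb H}\prod_{i=1}^m|f_i(z)|^{p_i}\,d\mu(z)\le C\prod_{i=1}^m\int_{\mathbb H}\left(\int_{Q_w}|f_i(z)|^{\sigma_i}\,dm_{\alpha_i}(z)\right)^{p_i/\sigma_i}dw,$$ where the integrals take values in $[0,\infty]$, with the convention $0\cdot\infty=0$ on the right-hand side. 2. There is a finite constant $C$ such that $$\mu(\Delta_k)\le C\,\eta_k^{\,m(n+1)+\sum_{i=1}^m p_i(n+1+\alpha_i)/\sigma_i}\qquad\text{for all } k\ge 1.$$ -/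

import Mathlib

open MeasureTheory Metric InnerProductSpace
open scoped NNReal ENNReal

/-- The space `ℝⁿ⁺¹` with its Euclidean structure; the last coordinate of `z = (x, t)` is `t`. -/
abbrev Space (n : ℕ) : Type := EuclideanSpace ℝ (Fin (n + 1))

/-- The height `t` of the point `z = (x, t)`. -/
def height {n : ℕ} (z : Space n) : ℝ := z (Fin.last n)

/-- The open upper half space `ℍ = {(x, t) : x ∈ ℝⁿ, t > 0}`. -/
def upperHalfSpace (n : ℕ) : Set (Space n) := {z | 0 < height z}

/-- The measure `dm_a(z) = t ^ a dx dt` on `ℍ`, as a measure on `ℝⁿ⁺¹` carried by `ℍ`. -/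
noncomputable def weightedMeasure (n : ℕ) (a : ℝ) : Measure (Space n) :=
  (volume.restrict (upperHalfSpace n)).withDensity fun z => ENNReal.ofReal (height z ^ a)

/-- The closed cube with centre `c`, side length `l` and sides parallel to the axes. -/
def cube {n : ℕ} (c : Space n) (l : ℝ) : Set (Space n) := {z | ∀ i, |z i - c i| ≤ l / 2}

/-- The cube `Q_w`, centred at `w = (y, s)` and of side length `s`. -/
def boxAt {n : ℕ} (w : Space n) : Set (Space n) := cube w (height w)

/-- The distance between two (non-empty) sets. -/
noncomputable def setDist {n : ℕ} (A B : Set (Space n)) : ℝ := sInf (Set.image2 dist A B)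

/-- The closed cubes `Δ_k` with centres `ζ k` and side lengths `l k` form a Whitney decomposition
of `ℍ`: they cover `ℍ`, their diameters are comparable with their distances to `∂ℍ`, their
interiors are pairwise disjoint, and the cubes `Δ_k*` (same centres, enlarged `5/4` times)
lie in `ℍ` and overlap boundedly. -/
structure IsWhitneyDecomposition {n : ℕ} (ζ : ℕ → Space n) (l : ℕ → ℝ) : Prop where
  side_pos : ∀ k, 0 < l k
  iUnion_eq : ⋃ k, cube (ζ k) (l k) = upperHalfSpace n
  diam_dist : ∃ a b : ℝ, 0 < a ∧ 0 < b ∧ ∀ k,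
    a * diam (cube (ζ k) (l k)) ≤ setDist (cube (ζ k) (l k)) (frontier (upperHalfSpace n)) ∧
    setDist (cube (ζ k) (l k)) (frontier (upperHalfSpace n)) ≤ b * diam (cube (ζ k) (l k))
  interior_disjoint : ∀ j k, j ≠ k →
    Disjoint (interior (cube (ζ j) (l j))) (interior (cube (ζ k) (l k)))
  enlarged_subset : ∀ k, cube (ζ k) (5 / 4 * l k) ⊆ upperHalfSpace n
  overlap : ∃ N : ℕ, ∀ z, {k | z ∈ cube (ζ k) (5 / 4 * l k)}.encard ≤ N

lemma frontier_upperHalfSpace (n : ℕ) : frontier (upperHalfSpace n) = {z | height z = 0} := by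
  have hs : Function.Surjective (EuclideanSpace.proj (Fin.last n) : Space n →L[ℝ] ℝ) :=
    fun t => ⟨EuclideanSpace.single (Fin.last n) t, by simp⟩
  have h := (ContinuousLinearMap.isOpenMap _ hs).preimage_frontier_eq_frontier_preimage
    (ContinuousLinearMap.continuous _) (Set.Ioi (0 : ℝ))
  rw [frontier_Ioi] at h
  exact h.symm

lemma abs_sub_lt_of_mem_interior_cube {n : ℕ} {c z : Space n} {l : ℝ}
    (hz : z ∈ interior (cube c l)) (i : Fin (n + 1)) : |z i - c i| < l / 2 := by
  have hs : Function.Surjective (EuclideanSpace.proj i : Space n →L[ℝ] ℝ) :=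
    fun t => ⟨EuclideanSpace.single i t, by simp⟩
  have h := (ContinuousLinearMap.isOpenMap _ hs).preimage_interior_eq_interior_preimage
    (ContinuousLinearMap.continuous _) (Set.Icc (c i - l / 2) (c i + l / 2))
  rw [interior_Icc] at h
  have hsub : cube c l ⊆
      (EuclideanSpace.proj i : Space n →L[ℝ] ℝ) ⁻¹' Set.Icc (c i - l / 2) (c i + l / 2) := by
    intro y hy
    have := abs_le.1 (hy i)
    change c i - l / 2 ≤ y i ∧ y i ≤ c i + l / 2
    constructor <;> linarith
  have h2 := interior_mono hsub hz
  rw [← h] at h2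
  change c i - l / 2 < z i ∧ z i < c i + l / 2 at h2
  rw [abs_lt]
  constructor <;> linarith [h2.1, h2.2]

lemma dist_le_of_mem_cube {n : ℕ} {c z w : Space n} {l : ℝ} (hz : z ∈ cube c l)
    (hw : w ∈ cube c l) : dist z w ≤ (n + 1) * l := by
  have hl : 0 ≤ l := by linarith [(abs_nonneg _).trans (hz 0)]
  rw [EuclideanSpace.dist_eq]
  refine Real.sqrt_le_iff.2 ⟨by positivity, ?_⟩
  have h1 : ∀ i ∈ Finset.univ, dist (z i) (w i) ^ 2 ≤ l ^ 2 := by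
    intro i _
    have h := abs_le.1 (hz i)
    have h' := abs_le.1 (hw i)
    rw [Real.dist_eq, sq_abs]
    exact sq_le_sq' (by linarith) (by linarith)
  refine (Finset.sum_le_sum h1).trans ?_
  simp only [Finset.sum_const, Finset.card_univ, Fintype.card_fin, nsmul_eq_mul]
  push_cast
  have : (0 : ℝ) ≤ n := by positivity
  nlinarith [sq_nonneg l, mul_nonneg this (sq_nonneg l), mul_nonneg (mul_nonneg this this) (sq_nonneg l)]

lemma norm_single_axis {n : ℕ} (i : Fin (n + 1)) (t : ℝ) :
    ‖(EuclideanSpace.single i t : Space n)‖ = ‖t‖ :=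
  PiLp.norm_single 2 (fun _ => ℝ) i t

/-- Whitney decompositions exist: the dyadic cubes `2 ^ j (a + [0,1]ⁿ) × [2 ^ j, 2 ^ (j + 1)]`. -/
theorem exists_isWhitneyDecomposition (n : ℕ) :
    ∃ (ζ : ℕ → Space n) (l : ℕ → ℝ), IsWhitneyDecomposition ζ l := by
  obtain ⟨d⟩ := nonempty_denumerable (ℤ × (Fin n → ℤ))
  let e : ℕ ≃ ℤ × (Fin n → ℤ) := (Denumerable.eqv _).symm
  let L : ℤ × (Fin n → ℤ) → ℝ := fun q => (2 : ℝ) ^ q.1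
  let b : ℤ × (Fin n → ℤ) → Fin (n + 1) → ℤ := fun q => Fin.snoc (α := fun _ => ℤ) q.2 1
  let Z : ℤ × (Fin n → ℤ) → Space n := fun q => WithLp.toLp 2 fun i => L q * (b q i + 1 / 2)
  have hL : ∀ q, 0 < L q := fun q => by positivity
  have hZ : ∀ q i, Z q i = L q * (b q i + 1 / 2) := fun q i => rfl
  have hbl : ∀ q, b q (Fin.last n) = 1 := fun q => by simp [b]
  have hbc : ∀ q i, b q (Fin.castSucc i) = q.2 i := fun q i => by simp [b]
  have hZl : ∀ q, Z q (Fin.last n) = L q * (3 / 2) := fun q => by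
    rw [hZ, hbl]; norm_num
  have hstep : ∀ {j k : ℤ}, (2 : ℝ) ^ j < 2 ^ (k + 1) → j ≤ k := by
    intro j k h
    have := (zpow_lt_zpow_iff_right₀ (by norm_num : (1 : ℝ) < 2)).1 h
    omega
  have hlow : ∀ q, ∀ z ∈ cube (Z q) (L q), L q ≤ height z ∧ height z ≤ 2 * L q := by
    intro q z hz
    have h := abs_le.1 (hz (Fin.last n))
    rw [hZl] at h
    unfold height
    constructor <;> linarith
  have hc : ∀ q, Z q ∈ cube (Z q) (L q) := fun q i => by
    have := hL q
    rw [sub_self, abs_zero]; positivity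
  refine ⟨fun k => Z (e k), fun k => L (e k), fun k => hL _, ?_, ?_, ?_, ?_, ?_⟩
  · apply Set.Subset.antisymm
    · refine Set.iUnion_subset fun k z hz => ?_
      exact (hL (e k)).trans_le (hlow _ z hz).1
    · intro z hz
      obtain ⟨j, hj1, hj2⟩ := exists_mem_Ico_zpow (show 0 < height z from hz) one_lt_two
      refine Set.mem_iUnion.2 ⟨e.symm (j, fun i => ⌊z (Fin.castSucc i) / 2 ^ j⌋), ?_⟩
      simp only [Equiv.apply_symm_apply]
      set q : ℤ × (Fin n → ℤ) := (j, fun i => ⌊z (Fin.castSucc i) / 2 ^ j⌋) with hq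
      have hLq : L q = 2 ^ j := rfl
      intro i
      refine Fin.lastCases ?_ (fun i => ?_) i
      · rw [hZl, abs_le, hLq]
        unfold height at hj1 hj2
        rw [zpow_add_one₀ (by norm_num)] at hj2
        constructor <;> linarith
      · have hp := hL q
        rw [hZ, hbc, hLq, abs_le]
        rw [hLq] at hp
        have h1 := Int.floor_le (z (Fin.castSucc i) / 2 ^ j)
        have h2 := Int.lt_floor_add_one (z (Fin.castSucc i) / 2 ^ j)
        rw [le_div_iff₀ hp] at h1
        rw [div_lt_iff₀ hp] at h2
        simp only [hq]
        constructor <;> nlinarith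
  · refine ⟨1 / (n + 1), 3, by positivity, by norm_num, fun k => ?_⟩
    set q := e k
    have hp := hL q
    have hd : diam (cube (Z q) (L q)) ≤ (n + 1) * L q :=
      diam_le_of_forall_dist_le (by positivity) fun z hz w hw => dist_le_of_mem_cube hz hw
    have hbdd : Bornology.IsBounded (cube (Z q) (L q)) :=
      isBounded_iff.2 ⟨(n + 1) * L q, fun z hz w hw => dist_le_of_mem_cube hz hw⟩
    rw [frontier_upperHalfSpace]
    have hy : Z q - EuclideanSpace.single (Fin.last n) (L q * (3 / 2)) ∈
        {z : Space n | height z = 0} := by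
      simp only [Set.mem_ofPred_eq, height, PiLp.sub_apply, hZl]
      simp
    have hv : Z q + EuclideanSpace.single (Fin.last n) (L q / 2) ∈ cube (Z q) (L q) := by
      intro i
      by_cases hi : i = Fin.last n
      · subst hi
        simp [abs_of_pos (half_pos hp)]
      · simp [hi, (half_pos hp).le]
    have hd2 : L q / 2 ≤ diam (cube (Z q) (L q)) := by
      have h := dist_le_diam_of_mem hbdd hv (hc q)
      rw [dist_eq_norm, add_sub_cancel_left, norm_single_axis, Real.norm_eq_abs,
        abs_of_pos (by positivity)] at h
      exact h
    constructor
    · have h1 : L q ≤ setDist (cube (Z q) (L q)) {z : Space n | height z = 0} := by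
        refine le_csInf ⟨_, _, hc q, _, hy, rfl⟩ ?_
        rintro _ ⟨z, hz, w, hw, rfl⟩
        have h2 := PiLp.norm_apply_le (z - w) (Fin.last n)
        rw [← dist_eq_norm, PiLp.sub_apply, Real.norm_eq_abs] at h2
        have h3 : w (Fin.last n) = 0 := hw
        rw [h3, sub_zero] at h2
        exact (hlow q z hz).1.trans ((le_abs_self _).trans h2)
      refine le_trans ?_ h1
      rw [one_div, inv_mul_le_iff₀ (by positivity)]
      exact hd
    · have h1 : setDist (cube (Z q) (L q)) {z : Space n | height z = 0} ≤ L q * (3 / 2) := by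
        have h2 : setDist (cube (Z q) (L q)) {z : Space n | height z = 0} ≤
            dist (Z q) (Z q - EuclideanSpace.single (Fin.last n) (L q * (3 / 2))) :=
          csInf_le ⟨0, by rintro _ ⟨z, _, w, _, rfl⟩; exact dist_nonneg⟩ ⟨_, hc q, _, hy, rfl⟩
        rw [dist_eq_norm, sub_sub_cancel, norm_single_axis, Real.norm_eq_abs,
          abs_of_pos (by positivity)] at h2
        exact h2
      linarith
  · intro k k' hne
    rw [Set.disjoint_left]
    intro z hz hz'
    apply hne
    apply e.injective
    have h := abs_sub_lt_of_mem_interior_cube hz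
    have h' := abs_sub_lt_of_mem_interior_cube hz'
    set q := e k
    set q' := e k'
    have hp := hL q
    have hp' := hL q'
    have g := abs_lt.1 (h (Fin.last n))
    have g' := abs_lt.1 (h' (Fin.last n))
    rw [hZl] at g g'
    have e1 : q.1 = q'.1 := by
      apply le_antisymm <;> apply hstep <;> rw [zpow_add_one₀ (by norm_num)]
      · change L q < L q' * 2
        linarith
      · change L q' < L q * 2
        linarith
    have e2 : L q = L q' := by simp only [L, e1]
    refine Prod.ext e1 (funext fun i => ?_)
    have g := abs_lt.1 (h (Fin.castSucc i))
    have g' := abs_lt.1 (h' (Fin.castSucc i))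
    rw [hZ, hbc] at g g'
    rw [← e2] at g'
    have k1 : (q.2 i : ℝ) < q'.2 i + 1 := lt_of_mul_lt_mul_left (a := L q) (by linarith) hp.le
    have k2 : (q'.2 i : ℝ) < q.2 i + 1 := lt_of_mul_lt_mul_left (a := L q) (by linarith) hp.le
    norm_cast at k1 k2
    omega
  · intro k z hz
    have h := abs_le.1 (hz (Fin.last n))
    rw [hZl] at h
    have := hL (e k)
    change 0 < z (Fin.last n)
    linarith
  · let T : Finset (ℤ × (Fin n → ℤ)) :=
      Finset.Icc (-1) 1 ×ˢ Fintype.piFinset fun _ => Finset.Icc (-1) 1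
    refine ⟨T.card, fun z => ?_⟩
    rcases Set.eq_empty_or_nonempty {k | z ∈ cube (Z (e k)) (5 / 4 * L (e k))} with h0 | ⟨k0, hk0⟩
    · rw [h0]; simp
    have key : ∀ k, z ∈ cube (Z (e k)) (5 / 4 * L (e k)) →
        7 / 8 * L (e k) ≤ height z ∧ height z ≤ 17 / 8 * L (e k) := by
      intro k hk
      have h := abs_le.1 (hk (Fin.last n))
      rw [hZl] at h
      unfold height
      constructor <;> linarith
    have hz : 0 < height z := by linarith [(key k0 hk0).1, hL (e k0)]
    obtain ⟨j, hj1, hj2⟩ := exists_mem_Ico_zpow hz one_lt_two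
    rw [zpow_add_one₀ (by norm_num)] at hj2
    let φ : ℕ → ℤ × (Fin n → ℤ) := fun k =>
      ((e k).1 - j, fun i => (e k).2 i - ⌊z (Fin.castSucc i) / L (e k)⌋)
    rw [← Set.encard_coe_eq_coe_finsetCard]
    refine Set.encard_le_encard_of_injOn (f := φ) ?_ ?_
    · intro k hk
      have hp := hL (e k)
      obtain ⟨g1, g2⟩ := key k hk
      have hjp : (0 : ℝ) < 2 ^ j := by positivity
      have u1 : (e k).1 ≤ j + 1 := by
        apply hstep
        rw [zpow_add_one₀ (by norm_num), zpow_add_one₀ (by norm_num)]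
        change L (e k) < _
        linarith
      have u2 : j ≤ (e k).1 + 1 := by
        apply hstep
        rw [zpow_add_one₀ (by norm_num), zpow_add_one₀ (by norm_num)]
        change _ < L (e k) * 2 * 2
        linarith
      simp only [T, φ, Finset.coe_product, Set.mem_prod, Finset.mem_coe, Finset.mem_Icc,
        Fintype.mem_piFinset]
      refine ⟨⟨by omega, by omega⟩, fun i => ?_⟩
      have g := abs_le.1 (hk (Fin.castSucc i))
      rw [hZ, hbc] at g
      have h1 := Int.floor_le (z (Fin.castSucc i) / L (e k))
      have h2 := Int.lt_floor_add_one (z (Fin.castSucc i) / L (e k))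
      rw [le_div_iff₀ hp] at h1
      rw [div_lt_iff₀ hp] at h2
      set F := ⌊z (Fin.castSucc i) / L (e k)⌋
      have k1 : (F : ℝ) < (e k).2 i + 2 := lt_of_mul_lt_mul_left (a := L (e k)) (by linarith) hp.le
      have k2 : ((e k).2 i : ℝ) < F + 2 := lt_of_mul_lt_mul_left (a := L (e k)) (by linarith) hp.le
      norm_cast at k1 k2
      omega
    · intro k _ k' _ hkk
      apply e.injective
      have h1 : (e k).1 = (e k').1 := by
        have := congrArg Prod.fst hkk
        simp only [φ] at this
        omega
      have h2 : L (e k) = L (e k') := by simp only [L, h1]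
      refine Prod.ext h1 (funext fun i => ?_)
      have := congrFun (congrArg Prod.snd hkk) i
      simp only [φ, h2] at this
      omega

/-! From the measure bound to the integral inequality: for harmonic `f` and every exponent `σ > 0`,
`|f(z)| ^ σ` is at most a constant times its average over a ball about `z` of radius comparable to
the height of `z`. That ball lies in `Q_w` for every `w` close to `z`, and the weight is essentially
constant on it. Raising to the power `p / σ` and averaging over such `w` bounds `|f| ^ p` on `Δ_k`
by `η_k ^ -(n + 1 + p (n + 1 + α) / σ)` times the integral over `Δ_k*` of the outer integrand on the
right. Multiplying over `i`, the bound on `μ(Δ_k)` cancels exactly the powers of `η_k`. Summing over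
`k`, a sum of products of nonnegative terms is at most the product of the sums, and bounded overlap
of the `Δ_k*` finishes (`IsWhitneyDecomposition.lintegral_prod_le`).

Conversely, all `f_i` are taken equal to one harmonic function adapted to `Δ_k`: the real part of a
Kelvin transform of `(t + i x₀) ^ (j + 1)`, with pole below the boundary at a depth comparable to
`η_k`. It is homogeneous of degree `-κ`, `κ = j + n`, about the pole, with `j` large enough that
every integral on the right converges and, by scaling, is at most a constant times `η_k ^ (n + 1 + p
(n + 1 + α) / σ - κ p)`. The pole is so deep that `t + i x₀` is nearly real on `Δ_k`, so there the
function is at least a constant times `η_k ^ -κ`. Dividing these powers out leaves the bound on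
`μ(Δ_k)` (`IsWhitneyDecomposition.exists_measure_cube_le`).

The sub-mean value property rests on a mean value formula with the radial weight `(1 - ‖y‖²)₊`,
which needs only integration by parts on the whole space and no surface measure. Integrals are
valued in `ℝ≥0∞`, so infinite right-hand sides need no separate case. -/

section Kelvin

/-! ### Harmonicity of Kelvin transforms of powers of a linear form -/

variable {E : Type*} [NormedAddCommGroup E] [InnerProductSpace ℝ E]

lemma hasDerivAt_norm_sq_line (y c v : E) :
    HasDerivAt (fun t : ℝ => ‖y + t • v - c‖ ^ 2) (2 * inner ℝ (y - c) v) 0 := by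
  have h : HasDerivAt (fun t : ℝ => y + t • v - c) v 0 := by
    simpa using (((hasDerivAt_id (0 : ℝ)).smul_const v).const_add y).sub_const c
  simpa using h.norm_sq

lemma hasDerivAt_clm_line {F : Type*} [NormedAddCommGroup F] [NormedSpace ℝ F] (L : E →L[ℝ] F)
    (y c v : E) : HasDerivAt (fun t : ℝ => L (y + t • v - c)) (L v) 0 := by
  have h : HasDerivAt (fun t : ℝ => y + t • v - c) v 0 := by
    simpa using (((hasDerivAt_id (0 : ℝ)).smul_const v).const_add y).sub_const c
  exact L.hasFDerivAt.comp_hasDerivAt 0 h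

/-- Reduces the computation of Fréchet derivatives to one-variable calculus along lines, once
differentiability is known. -/
lemma fderiv_apply_eq_of_hasDerivAt_line {F : Type*} [NormedAddCommGroup F] [NormedSpace ℝ F]
    {f : E → F} {y v : E} {f' : F} (hf : DifferentiableAt ℝ f y)
    (h : HasDerivAt (fun t : ℝ => f (y + t • v)) f' 0) : fderiv ℝ f y v = f' := by
  have h2 := hf.hasFDerivAt.hasLineDerivAt v
  exact HasDerivAt.unique h2 h

lemma hasDerivAt_norm_sq_rpow_line {y c : E} (hy : y ≠ c) (v : E) (b : ℝ) :
    HasDerivAt (fun t : ℝ => (((‖y + t • v - c‖ ^ 2) ^ b : ℝ) : ℂ))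
      ((b * (‖y - c‖ ^ 2) ^ (b - 1) * (2 * inner ℝ (y - c) v) : ℝ) : ℂ) 0 := by
  have h0 : 0 < ‖y - c‖ ^ 2 := by
    have := norm_pos_iff.2 (sub_ne_zero.2 hy)
    positivity
  have h := (hasDerivAt_norm_sq_line y c v).rpow_const (p := b) (Or.inl (by simpa using h0.ne'))
  have h2 := h.ofReal_comp
  refine h2.congr_deriv ?_
  simp
  ring

/-- The Kelvin transform of the harmonic polynomial `L ^ (k + 1)`, up to the choice of `β`. -/
noncomputable def kelvin (L : E →L[ℝ] ℂ) (k : ℕ) (β : ℝ) (c y : E) : ℂ :=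
  L (y - c) ^ (k + 1) * (((‖y - c‖ ^ 2) ^ (-β) : ℝ) : ℂ)

lemma contDiffAt_kelvin (L : E →L[ℝ] ℂ) (k : ℕ) (β : ℝ) {c y : E} (hy : y ≠ c) :
    ContDiffAt ℝ 2 (kelvin L k β c) y := by
  have h0 : ‖y - c‖ ^ 2 ≠ 0 := by
    have := norm_pos_iff.2 (sub_ne_zero.2 hy)
    positivity
  unfold kelvin
  refine ContDiffAt.mul ?_ ?_
  · exact (L.contDiff.contDiffAt.comp y (contDiffAt_id.sub contDiffAt_const)).pow _
  · refine Complex.ofRealCLM.contDiff.contDiffAt.comp y ?_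
    exact ((contDiffAt_id.sub contDiffAt_const).norm_sq ℝ).rpow_const_of_ne h0

lemma fderiv_kelvin_apply (L : E →L[ℝ] ℂ) (k : ℕ) (β : ℝ) {c y : E} (hy : y ≠ c) (v : E) :
    fderiv ℝ (kelvin L k β c) y v =
      (k + 1) * L v * (L (y - c) ^ k * (((‖y - c‖ ^ 2) ^ (-β) : ℝ) : ℂ)) +
      (-β * 2) * (L (y - c) ^ (k + 1) * (((‖y - c‖ ^ 2) ^ (-β - 1) : ℝ) : ℂ) *
        ((inner ℝ (y - c) v : ℝ) : ℂ)) := by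
  refine fderiv_apply_eq_of_hasDerivAt_line
    ((contDiffAt_kelvin L k β hy).differentiableAt (by norm_num)) ?_
  have h := ((hasDerivAt_clm_line L y c v).pow (k + 1)).mul
    (hasDerivAt_norm_sq_rpow_line hy v (-β))
  refine h.congr_deriv ?_
  simp
  ring

/-- Only pure second derivatives enter the Laplacian. For `k = 0` the truncated exponent `k - 1` is
harmless, because that term carries a factor `k`. -/
lemma fderiv_fderiv_kelvin_apply (L : E →L[ℝ] ℂ) (k : ℕ) (β : ℝ) {c y : E} (hy : y ≠ c) (v : E) :
    fderiv ℝ (fderiv ℝ (kelvin L k β c)) y v v =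
      (k + 1) * L v * (k * L (y - c) ^ (k - 1) * L v * (((‖y - c‖ ^ 2) ^ (-β) : ℝ) : ℂ)) +
      (-β * 4 * (k + 1)) * (L (y - c) ^ k * (((‖y - c‖ ^ 2) ^ (-β - 1) : ℝ) : ℂ) *
        (L v * ((inner ℝ (y - c) v : ℝ) : ℂ))) +
      (-β * 2) * (L (y - c) ^ (k + 1) * (((-β - 1) * 2 * (((‖y - c‖ ^ 2) ^ (-β - 2) : ℝ) : ℂ)) *
        ((inner ℝ (y - c) v : ℝ) : ℂ) ^ 2 + (((‖y - c‖ ^ 2) ^ (-β - 1) : ℝ) : ℂ) *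
        ((inner ℝ v v : ℝ) : ℂ))) := by
  have hd : DifferentiableAt ℝ (fderiv ℝ (kelvin L k β c)) y :=
    ((contDiffAt_kelvin L k β hy).fderiv_right (m := 1) (by norm_num)).differentiableAt
      (by norm_num)
  have h1 : fderiv ℝ (fderiv ℝ (kelvin L k β c)) y v v =
      fderiv ℝ (fun x => fderiv ℝ (kelvin L k β c) x v) y v := by
    rw [fderiv_clm_apply hd (differentiableAt_const v)]
    simp
  have hd2 : DifferentiableAt ℝ (fun x => fderiv ℝ (kelvin L k β c) x v) y :=
    hd.clm_apply (differentiableAt_const v)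
  have hev : (fun x => fderiv ℝ (kelvin L k β c) x v) =ᶠ[nhds y] fun y =>
      (k + 1) * L v * (L (y - c) ^ k * (((‖y - c‖ ^ 2) ^ (-β) : ℝ) : ℂ)) +
      (-β * 2) * (L (y - c) ^ (k + 1) * (((‖y - c‖ ^ 2) ^ (-β - 1) : ℝ) : ℂ) *
        ((inner ℝ (y - c) v : ℝ) : ℂ)) := by
    filter_upwards [isOpen_ne.mem_nhds hy] with x hx using fderiv_kelvin_apply L k β hx v
  rw [h1, hev.fderiv_eq]
  refine fderiv_apply_eq_of_hasDerivAt_line (hev.differentiableAt_iff.1 hd2) ?_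
  have hi : HasDerivAt (fun t : ℝ => ((inner ℝ (y + t • v - c) v : ℝ) : ℂ))
      ((inner ℝ v v : ℝ) : ℂ) 0 := by
    have := (hasDerivAt_clm_line (innerSL ℝ v) y c v).ofReal_comp
    simpa [real_inner_comm] using this
  have hA := (((hasDerivAt_clm_line L y c v).pow k).mul
    (hasDerivAt_norm_sq_rpow_line hy v (-β))).const_mul ((k + 1) * L v)
  have hB := ((((hasDerivAt_clm_line L y c v).pow (k + 1)).mul
    (hasDerivAt_norm_sq_rpow_line hy v (-β - 1))).mul hi).const_mul (-(β : ℂ) * 2)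
  refine (hA.add hB).congr_deriv ?_
  have e : -β - 1 - 1 = -β - 2 := by ring
  simp [e]
  ring

/-- Summed over the basis, the term with `L (b i) ^ 2` vanishes because `L` is isotropic (`hL`), and
`∑ L (b i) ⟪y - c, b i⟫ = L (y - c)`. What remains is `L (y - c) ^ (k + 1) ‖y - c‖ ^ (-2β - 2)`
times `2β (2β - 2k - dim)`, so `hβ` is exactly the vanishing condition. -/
lemma harmonicAt_kelvin [FiniteDimensional ℝ E] {ι : Type*} [Fintype ι]
    (b : OrthonormalBasis ι ℝ E) (L : E →L[ℝ] ℂ)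
    (hL : ∑ i, L (b i) ^ 2 = 0) (k : ℕ) {β : ℝ} (hβ : 2 * β = 2 * k + Fintype.card ι) {c z : E}
    (hz : z ≠ c) : HarmonicAt (kelvin L k β c) z := by
  refine ⟨contDiffAt_kelvin L k β hz, ?_⟩
  filter_upwards [isOpen_ne.mem_nhds hz] with y hy
  have h0 : 0 < ‖y - c‖ ^ 2 := by
    have := norm_pos_iff.2 (sub_ne_zero.2 hy)
    positivity
  rw [laplacian_eq_iteratedFDeriv_orthonormalBasis _ b]
  simp only [iteratedFDeriv_two_apply, Matrix.cons_val_zero, Matrix.cons_val_one,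
    fderiv_fderiv_kelvin_apply L k β hy, Pi.zero_apply]
  have s1 : ∑ i, L (b i) * ((inner ℝ (y - c) (b i) : ℝ) : ℂ) = L (y - c) := by
    generalize y - c = u
    conv_rhs => rw [← b.sum_repr u]
    simp [b.repr_apply_apply, real_inner_comm, mul_comm]
  have s2 : ∑ i, ((inner ℝ (y - c) (b i) : ℝ) : ℂ) ^ 2 = ((‖y - c‖ ^ 2 : ℝ) : ℂ) := by
    rw [← b.sum_sq_inner_left (y - c)]
    push_cast
    rfl
  have s3 : ∀ i, inner ℝ (b i) (b i) = (1 : ℝ) := fun i => by simp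
  have e1 : (‖y - c‖ ^ 2) ^ (-β - 1) = (‖y - c‖ ^ 2) ^ (-β - 2) * ‖y - c‖ ^ 2 := by
    rw [← Real.rpow_add_one h0.ne']
    ring_nf
  have hβ' : (2 * β : ℂ) = 2 * k + Fintype.card ι := by exact_mod_cast hβ
  have s4 : ∀ i, (k + 1) * L (b i) * (k * L (y - c) ^ (k - 1) * L (b i) *
      (((‖y - c‖ ^ 2) ^ (-β) : ℝ) : ℂ)) =
      ((k + 1) * (k * L (y - c) ^ (k - 1) * (((‖y - c‖ ^ 2) ^ (-β) : ℝ) : ℂ))) * L (b i) ^ 2 :=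
    fun i => by ring
  simp only [s3, s4, Finset.sum_add_distrib, ← Finset.mul_sum, s1, s2, hL]
  simp only [Complex.ofReal_one, mul_one, Finset.sum_const, Finset.card_univ, nsmul_eq_mul, e1]
  push_cast
  linear_combination (2 * (β : ℂ) * L (y - c) ^ (k + 1) *
    (((‖y - c‖ ^ 2) ^ (-β - 2) : ℝ) : ℂ) * (‖y - c‖ : ℂ) ^ 2) * hβ'

end Kelvin

/-! ### A mean value formula with a radial weight -/

lemma hasDerivAt_max_zero_sq (s : ℝ) :
    HasDerivAt (fun s : ℝ => max s 0 ^ 2) (2 * max s 0) s := by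
  rcases lt_trichotomy s 0 with hs | rfl | hs
  · rw [max_eq_right hs.le, mul_zero]
    refine (hasDerivAt_const s (0 : ℝ)).congr_of_eventuallyEq ?_
    filter_upwards [isOpen_Iio.mem_nhds hs] with t ht
    simp [max_eq_right (show t ≤ 0 from le_of_lt ht)]
  · rw [max_self, mul_zero, hasDerivAt_iff_isLittleO_nhds_zero]
    have h : (fun h : ℝ => h ^ 2) =o[nhds 0] fun h : ℝ => h := by
      simpa using Asymptotics.isLittleO_pow_pow (𝕜 := ℝ) (m := 1) (n := 2) (by norm_num)
    refine Asymptotics.IsBigO.trans_isLittleO (Asymptotics.IsBigO.of_bound 1 ?_) h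
    refine Filter.Eventually.of_forall fun t => ?_
    rcases le_total t 0 with ht | ht <;> simp [ht]
    positivity
  · rw [max_eq_left hs.le]
    have h := hasDerivAt_pow 2 s
    refine (h.congr_deriv (by simp)).congr_of_eventuallyEq ?_
    filter_upwards [isOpen_Ioi.mem_nhds hs] with t ht
    rw [max_eq_left (show 0 ≤ t from le_of_lt ht)]

section MeanValue

variable {E : Type*} [NormedAddCommGroup E] [InnerProductSpace ℝ E]

lemma hasFDerivAt_bump (y : E) :
    HasFDerivAt (fun y : E => max (1 - ‖y‖ ^ 2) 0 ^ 2)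
      ((-4 * max (1 - ‖y‖ ^ 2) 0) • innerSL ℝ y) y := by
  have h1 : HasFDerivAt (fun y : E => 1 - ‖y‖ ^ 2) (-(2 • innerSL ℝ y)) y :=
    (hasStrictFDerivAt_norm_sq y).hasFDerivAt.const_sub 1
  have h := (hasDerivAt_max_zero_sq (1 - ‖y‖ ^ 2)).comp_hasFDerivAt y h1
  refine h.congr_fderiv ?_
  ext v
  simp
  ring

lemma support_cutoff_subset {E : Type*} [NormedAddCommGroup E] :
    Function.support (fun y : E => max (1 - ‖y‖ ^ 2) 0) ⊆ ball 0 1 := by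
  intro y hy
  rw [mem_ball_zero_iff]
  by_contra! h
  exact hy (max_eq_right (by nlinarith))

lemma mem_ball_of_mem_closedBall_one {z y : E} {t R : ℝ} (ht : |t| < R)
    (hy : y ∈ closedBall (0 : E) 1) : z + t • y ∈ ball z R := by
  rw [mem_ball, dist_eq_norm, add_sub_cancel_left, norm_smul, Real.norm_eq_abs]
  rw [mem_closedBall_zero_iff] at hy
  nlinarith [abs_nonneg t, norm_nonneg y]

lemma continuousOn_comp_line {G : Type*} [TopologicalSpace G] {g : E → G} {z : E} {t R : ℝ}
    (hg : ContinuousOn g (ball z R)) (ht : |t| < R) :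
    ContinuousOn (fun y => g (z + t • y)) (closedBall 0 1) :=
  hg.comp (by fun_prop) fun y hy => mem_ball_of_mem_closedBall_one ht hy

variable [FiniteDimensional ℝ E] {F : Type*} [NormedAddCommGroup F]

lemma integrable_of_continuousOn_closedBall [MeasurableSpace E] [BorelSpace E] {g : E → F} (hg : ContinuousOn g (closedBall 0 1))
    (hs : Function.support g ⊆ closedBall 0 1) : Integrable g volume :=
  (integrableOn_iff_integrable_of_support_subset hs).1
    (hg.integrableOn_compact (isCompact_closedBall 0 1))

variable [NormedSpace ℝ F]

lemma InnerProductSpace.HarmonicOnNhd.continuousOn_fderiv {f : E → F} {z : E} {R : ℝ}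
    (hf : HarmonicOnNhd f (ball z R)) : ContinuousOn (fderiv ℝ f) (ball z R) :=
  hf.contDiffOn.continuousOn_fderiv_of_isOpen isOpen_ball (by norm_num)

variable [MeasurableSpace E] [BorelSpace E]

/-- Integration by parts: the radial derivative of a harmonic function is orthogonal to the radial
weight `(1 - ‖y‖²)₊`. -/
lemma InnerProductSpace.HarmonicOnNhd.integral_radial_fderiv_eq_zero {f : E → F} {z : E} {R t : ℝ}
    (hf : HarmonicOnNhd f (ball z R)) (ht : |t| < R) :
    ∫ y : E, max (1 - ‖y‖ ^ 2) 0 • fderiv ℝ f (z + t • y) y = 0 := by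
  let b := stdOrthonormalBasis ℝ E
  have hcd : ∀ y ∈ closedBall (0 : E) 1, ContDiffAt ℝ 2 f (z + t • y) :=
    fun y hy => (hf _ (mem_ball_of_mem_closedBall_one ht hy)).1
  have hsupp : Function.support (fun y : E => max (1 - ‖y‖ ^ 2) 0 ^ 2) ⊆ closedBall 0 1 := by
    intro y hy
    exact ball_subset_closedBall (support_cutoff_subset fun h => hy (by simp [h]))
  have htsupp : tsupport (fun y : E => max (1 - ‖y‖ ^ 2) 0 ^ 2) ⊆ closedBall 0 1 :=
    closure_minimal hsupp isClosed_closedBall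
  have hc1 := continuousOn_comp_line hf.continuousOn_fderiv ht
  have hd : ∀ y ∈ closedBall (0 : E) 1, DifferentiableAt ℝ (fderiv ℝ f) (z + t • y) :=
    fun y hy => ((hcd y hy).fderiv_right (m := 1) (by norm_num)).differentiableAt (by norm_num)
  have hu : ∀ i, ∀ y ∈ closedBall (0 : E) 1,
      HasFDerivAt (fun y => fderiv ℝ f (z + t • y) (b i))
        (t • (fderiv ℝ (fderiv ℝ f) (z + t • y)).flip (b i)) y := by
    intro i y hy
    have h1 : HasFDerivAt (fun y : E => z + t • y) (t • ContinuousLinearMap.id ℝ E) y :=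
      ((hasFDerivAt_id y).const_smul t).const_add z
    have h2 := ((hd y hy).hasFDerivAt.comp y h1).clm_apply (hasFDerivAt_const (b i) y)
    refine h2.congr_fderiv ?_
    ext v
    simp
  have hc2 : ContinuousOn (fun y => fderiv ℝ (fderiv ℝ f) (z + t • y)) (closedBall 0 1) := by
    refine continuousOn_comp_line (g := fderiv ℝ (fderiv ℝ f)) ?_ ht
    exact (hf.contDiffOn.fderiv_of_isOpen (m := 1) isOpen_ball
      (by norm_num)).continuousOn_fderiv_of_isOpen isOpen_ball (by norm_num)
  -- Since `(1 - ‖y‖²)₊²` has gradient `-4 (1 - ‖y‖²)₊ y`, moving a derivative off it in direction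
  -- `b i` and summing over `i` gives the radial derivative on the left and `t` times the Laplacian
  -- of `f` on the right.
  have key : ∀ i, ∫ y : E, (4 * (max (1 - ‖y‖ ^ 2) 0 * inner ℝ y (b i))) •
        fderiv ℝ f (z + t • y) (b i) =
      ∫ y : E, max (1 - ‖y‖ ^ 2) 0 ^ 2 •
        (t • fderiv ℝ (fderiv ℝ f) (z + t • y) (b i) (b i)) := by
    intro i
    have h := integral_bilinear_hasFDerivAt_right_eq_neg_left_of_integrable (μ := volume)
      (f := fun y : E => max (1 - ‖y‖ ^ 2) 0 ^ 2)
      (f' := fun y => (-4 * max (1 - ‖y‖ ^ 2) 0) • innerSL ℝ y)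
      (g := fun y => fderiv ℝ f (z + t • y) (b i))
      (g' := fun y => t • (fderiv ℝ (fderiv ℝ f) (z + t • y)).flip (b i))
      (v := b i) (B := ContinuousLinearMap.lsmul ℝ ℝ) ?_ ?_ ?_
      (fun y _ => hasFDerivAt_bump y) (fun y hy => hu i y (htsupp hy))
    · simp only [ContinuousLinearMap.lsmul_apply] at h
      refine Eq.trans ?_ h.symm
      rw [← integral_neg]
      refine integral_congr_ae (Filter.Eventually.of_forall fun y => ?_)
      simp only [← neg_smul]
      congr 1
      simp
      ring
    · refine integrable_of_continuousOn_closedBall ?_ ?_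
      · simp only [ContinuousLinearMap.lsmul_apply]
        refine ContinuousOn.smul ?_ (hc1.clm_apply continuousOn_const)
        simp only [smul_apply, innerSL_apply_apply]
        fun_prop
      · refine fun y hy => ball_subset_closedBall (support_cutoff_subset fun h => hy ?_)
        simp only [h]
        simp
    · refine integrable_of_continuousOn_closedBall ?_ ?_
      · simp only [ContinuousLinearMap.lsmul_apply]
        refine ContinuousOn.smul (by fun_prop) ?_
        exact ((hc2.clm_apply continuousOn_const).clm_apply continuousOn_const).const_smul t
      · refine fun y hy => hsupp fun h => hy ?_
        simp only [h]
        simp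
    · refine integrable_of_continuousOn_closedBall ?_ ?_
      · simp only [ContinuousLinearMap.lsmul_apply]
        exact ContinuousOn.smul (by fun_prop) (hc1.clm_apply continuousOn_const)
      · refine fun y hy => hsupp fun h => hy ?_
        simp only [h]
        simp
  have hint1 : ∀ i, Integrable (fun y : E => (4 * (max (1 - ‖y‖ ^ 2) 0 * inner ℝ y (b i))) •
        fderiv ℝ f (z + t • y) (b i)) := by
    intro i
    refine integrable_of_continuousOn_closedBall ?_ ?_
    · exact ContinuousOn.smul (by fun_prop) (hc1.clm_apply continuousOn_const)
    · refine fun y hy => ball_subset_closedBall (support_cutoff_subset fun h => hy ?_)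
      simp only [h]
      simp
  have hint2 : ∀ i, Integrable (fun y : E => max (1 - ‖y‖ ^ 2) 0 ^ 2 •
        (t • fderiv ℝ (fderiv ℝ f) (z + t • y) (b i) (b i))) := by
    intro i
    refine integrable_of_continuousOn_closedBall ?_ ?_
    · refine ContinuousOn.smul (by fun_prop) ?_
      exact ((hc2.clm_apply continuousOn_const).clm_apply continuousOn_const).const_smul t
    · refine fun y hy => hsupp fun h => hy ?_
      simp only [h]
      simp
  have hsum := Finset.sum_congr (rfl : Finset.univ = Finset.univ) fun i _ => key i
  rw [← integral_finsetSum _ fun i _ => hint1 i, ← integral_finsetSum _ fun i _ => hint2 i] at hsum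
  have hz : ∫ y : E, ∑ i, max (1 - ‖y‖ ^ 2) 0 ^ 2 •
        (t • fderiv ℝ (fderiv ℝ f) (z + t • y) (b i) (b i)) = 0 := by
    rw [← integral_zero E F]
    refine integral_congr_ae (Filter.Eventually.of_forall fun y => ?_)
    by_cases hy : y ∈ closedBall (0 : E) 1
    · have h1 := (hf _ (mem_ball_of_mem_closedBall_one (z := z) ht hy)).2.self_of_nhds
      rw [laplacian_eq_iteratedFDeriv_orthonormalBasis _ b] at h1
      simp only [iteratedFDeriv_two_apply, Matrix.cons_val_zero, Matrix.cons_val_one,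
        Pi.zero_apply] at h1
      simp only [← Finset.smul_sum, h1, smul_zero]
    · have : max (1 - ‖y‖ ^ 2) 0 ^ 2 = 0 := by
        by_contra h
        exact hy (hsupp h)
      simp only [this, zero_smul, Finset.sum_const_zero]
  rw [hz] at hsum
  have hrad : ∀ y : E, ∑ i, (4 * (max (1 - ‖y‖ ^ 2) 0 * inner ℝ y (b i))) •
        fderiv ℝ f (z + t • y) (b i) =
      (4 : ℝ) • (max (1 - ‖y‖ ^ 2) 0 • fderiv ℝ f (z + t • y) y) := by
    intro y
    have h : fderiv ℝ f (z + t • y) y =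
        ∑ i, (inner ℝ y (b i) : ℝ) • fderiv ℝ f (z + t • y) (b i) := by
      generalize fderiv ℝ f (z + t • y) = A
      conv_lhs => rw [← b.sum_repr y]
      simp [b.repr_apply_apply, real_inner_comm]
    rw [h]
    simp only [Finset.smul_sum, smul_smul]
  simp only [hrad] at hsum
  rw [integral_smul] at hsum
  exact (smul_eq_zero.1 hsum).resolve_left (by norm_num)

/-- Mean value property of harmonic functions with the radial weight `(1 - ‖y‖²)₊`. -/
theorem InnerProductSpace.HarmonicOnNhd.integral_cutoff_smul [CompleteSpace F] {f : E → F} {z : E} {R t : ℝ}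
    (hf : HarmonicOnNhd f (ball z R)) (ht : |t| < R) :
    ∫ y : E, max (1 - ‖y‖ ^ 2) 0 • f (z + t • y) = (∫ y : E, max (1 - ‖y‖ ^ 2) 0) • f z := by
  have hφ : Continuous fun y : E => max (1 - ‖y‖ ^ 2) 0 := by fun_prop
  have hφ1 : ∀ y : E, ‖max (1 - ‖y‖ ^ 2) 0‖ ≤ 1 := by
    intro y
    rw [Real.norm_of_nonneg (le_max_right _ _)]
    exact max_le (by nlinarith [norm_nonneg y]) zero_le_one
  have hsupp : ∀ g : E → F,
      Function.support (fun y : E => max (1 - ‖y‖ ^ 2) 0 • g y) ⊆ closedBall 0 1 := by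
    intro g y hy
    refine ball_subset_closedBall (support_cutoff_subset fun h => hy ?_)
    simp only [h, zero_smul]
  have hint : ∀ s : ℝ, |s| < R →
      Integrable (fun y : E => max (1 - ‖y‖ ^ 2) 0 • f (z + s • y)) := fun s hs =>
    integrable_of_continuousOn_closedBall
      (hφ.continuousOn.smul (continuousOn_comp_line hf.continuousOn hs)) (hsupp _)
  have hint' : ∀ s : ℝ, |s| < R →
      Integrable (fun y : E => max (1 - ‖y‖ ^ 2) 0 • fderiv ℝ f (z + s • y) y) := fun s hs =>
    integrable_of_continuousOn_closedBall
      (hφ.continuousOn.smul ((continuousOn_comp_line hf.continuousOn_fderiv hs).clm_apply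
        continuousOn_id)) (hsupp _)
  -- The weighted average is constant in the dilation parameter, because its derivative is the
  -- radial integral just shown to vanish; at parameter `0` it is a multiple of `f z`.
  have hder : ∀ s ∈ Set.Ioo (-R) R,
      HasDerivAt (fun s : ℝ => ∫ y : E, max (1 - ‖y‖ ^ 2) 0 • f (z + s • y)) 0 s := by
    intro s hs
    have hs' : |s| < R := abs_lt.2 hs
    -- An intermediate radius gives a compact ball on which `fderiv ℝ f` is bounded, which supplies
    -- the dominating function.
    obtain ⟨r, hr1, hr2⟩ := exists_between hs'
    obtain ⟨B, hB⟩ := ((isCompact_closedBall z r).image_of_continuousOn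
      (hf.continuousOn_fderiv.mono (closedBall_subset_ball hr2))).isBounded.exists_norm_le
    have hmem : {x : ℝ | |x| < r} ∈ nhds s :=
      (isOpen_lt continuous_abs continuous_const).mem_nhds hr1
    have h := (hasDerivAt_integral_of_dominated_loc_of_deriv_le (μ := (volume : Measure E))
      (F := fun (s : ℝ) (y : E) => max (1 - ‖y‖ ^ 2) 0 • f (z + s • y))
      (F' := fun (s : ℝ) (y : E) => max (1 - ‖y‖ ^ 2) 0 • fderiv ℝ f (z + s • y) y)
      (x₀ := s) (bound := (closedBall (0 : E) 1).indicator fun _ => B) hmem ?_ (hint s hs')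
      (hint' s hs').aestronglyMeasurable ?_ ?_ ?_).2
    · rwa [hf.integral_radial_fderiv_eq_zero hs'] at h
    · filter_upwards [hmem] with x hx
      exact (hint x (lt_trans hx hr2)).aestronglyMeasurable
    · refine Filter.Eventually.of_forall fun y x hx => ?_
      by_cases hy : y ∈ closedBall (0 : E) 1
      · rw [Set.indicator_of_mem hy, norm_smul]
        have h1 := hB _ ⟨_, ball_subset_closedBall
          (mem_ball_of_mem_closedBall_one (z := z) hx hy), rfl⟩
        have h2 := (fderiv ℝ f (z + x • y)).le_opNorm y
        rw [mem_closedBall_zero_iff] at hy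
        have h3 : ‖fderiv ℝ f (z + x • y)‖ * ‖y‖ ≤ B := by
          nlinarith [norm_nonneg (fderiv ℝ f (z + x • y)), norm_nonneg y]
        nlinarith [hφ1 y, norm_nonneg (max (1 - ‖y‖ ^ 2) 0),
          norm_nonneg ((fderiv ℝ f (z + x • y)) y)]
      · rw [Set.indicator_of_notMem hy]
        have : max (1 - ‖y‖ ^ 2) 0 = 0 := by
          by_contra h
          exact hy (ball_subset_closedBall (support_cutoff_subset h))
        simp [this]
    · exact (integrable_indicator_iff measurableSet_closedBall).2
        (integrableOn_const measure_closedBall_lt_top.ne)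
    · refine Filter.Eventually.of_forall fun y x hx => ?_
      by_cases hy : y ∈ closedBall (0 : E) 1
      · have hx' : |x| < R := lt_trans hx hr2
        have h1 : HasDerivAt (fun x : ℝ => z + x • y) y x := by
          simpa using ((hasDerivAt_id x).smul_const y).const_add z
        exact (((hf _ (mem_ball_of_mem_closedBall_one hx' hy)).1.differentiableAt
          (by norm_num)).hasFDerivAt.comp_hasDerivAt x h1).const_smul _
      · have : max (1 - ‖y‖ ^ 2) 0 = 0 := by
          by_contra h
          exact hy (ball_subset_closedBall (support_cutoff_subset h))
        simp only [this, zero_smul]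
        exact hasDerivAt_const x 0
  have h0 : (0 : ℝ) ∈ Set.Ioo (-R) R := by
    have := (abs_nonneg t).trans_lt ht
    constructor <;> linarith
  have hconst := isOpen_Ioo.is_const_of_deriv_eq_zero (isPreconnected_Ioo)
    (fun s hs => (hder s hs).differentiableAt.differentiableWithinAt)
    (fun s hs => (hder s hs).deriv) (abs_lt.1 ht) h0
  rw [hconst]
  simp only [zero_smul, add_zero]
  exact integral_smul_const _ _

end MeanValue

/-! ### Sub-mean value property for all positive exponents -/

section SubMeanValue

variable {E : Type*} [NormedAddCommGroup E] [InnerProductSpace ℝ E] [FiniteDimensional ℝ E]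
  [MeasurableSpace E] [BorelSpace E]

/-- Dilation is a measurable equivalence and translation preserves the integral, so no measurability
of `g` is needed. -/
lemma lintegral_comp_add_smul (g : E → ℝ≥0∞) (z : E) {r : ℝ} (hr : 0 < r) :
    ∫⁻ y, g (z + r • y) = ENNReal.ofReal (r ^ Module.finrank ℝ E)⁻¹ * ∫⁻ y, g y := by
  have h := lintegral_map_equiv (μ := (volume : Measure E)) (fun y => g (z + y))
    (Homeomorph.smulOfNeZero r hr.ne').toMeasurableEquiv
  have h2 : Measure.map (Homeomorph.smulOfNeZero r hr.ne').toMeasurableEquiv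
      (volume : Measure E) = Measure.map (r • ·) volume := rfl
  rw [h2, Measure.map_addHaar_smul _ hr.ne', lintegral_smul_measure,
    lintegral_add_left_eq_self, abs_of_nonneg (by positivity)] at h
  exact h.symm

lemma integral_cutoff_pos : 0 < ∫ y : E, max (1 - ‖y‖ ^ 2) 0 := by
  refine Continuous.integral_pos_of_hasCompactSupport_nonneg_nonzero (x := 0) (by fun_prop) ?_
    (fun y => le_max_right _ _) (by simp)
  exact HasCompactSupport.of_support_subset_isCompact (isCompact_closedBall 0 1)
    (support_cutoff_subset.trans ball_subset_closedBall)

variable {F : Type*} [NormedAddCommGroup F] [NormedSpace ℝ F] [CompleteSpace F]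

variable (E F) in
lemma exists_enorm_le_setLIntegral_ball : ∃ C : ℝ≥0, ∀ (f : E → F) (z : E) (R r : ℝ), 0 < r →
    r < R → HarmonicOnNhd f (ball z R) →
      ‖f z‖ₑ ≤ C * ENNReal.ofReal (r ^ Module.finrank ℝ E)⁻¹ * ∫⁻ y in ball z r, ‖f y‖ₑ := by
  set c := ∫ y : E, max (1 - ‖y‖ ^ 2) 0 with hc
  have hc0 : 0 < c := integral_cutoff_pos
  refine ⟨Real.toNNReal c⁻¹, fun f z R r hr hrR hf => ?_⟩
  have h1 := hf.integral_cutoff_smul (t := r) (by rwa [abs_of_pos hr])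
  have h2 : f z = c⁻¹ • ∫ y : E, max (1 - ‖y‖ ^ 2) 0 • f (z + r • y) := by
    rw [h1, ← hc, smul_smul, inv_mul_cancel₀ hc0.ne', one_smul]
  have h3 : ∫⁻ y : E, ‖max (1 - ‖y‖ ^ 2) 0 • f (z + r • y)‖ₑ ≤
      ∫⁻ y : E, (ball z r).indicator (fun y => ‖f y‖ₑ) (z + r • y) := by
    refine lintegral_mono fun y => ?_
    by_cases hy : y ∈ ball (0 : E) 1
    · have hm : z + r • y ∈ ball z r := by
        rw [mem_ball_zero_iff] at hy
        rw [mem_ball, dist_eq_norm, add_sub_cancel_left, norm_smul, Real.norm_eq_abs,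
          abs_of_pos hr]
        nlinarith
      rw [Set.indicator_of_mem hm, enorm_smul]
      refine mul_le_of_le_one_left zero_le ?_
      rw [Real.enorm_eq_ofReal (le_max_right _ _), ENNReal.ofReal_le_one]
      exact max_le (by nlinarith [norm_nonneg y]) zero_le_one
    · have : max (1 - ‖y‖ ^ 2) 0 = 0 := by
        by_contra h
        exact hy (support_cutoff_subset h)
      simp [this]
  rw [lintegral_comp_add_smul _ z hr, lintegral_indicator measurableSet_ball] at h3
  rw [h2, enorm_smul, mul_assoc, Real.enorm_eq_ofReal (by positivity)]
  exact mul_le_mul_right ((enorm_integral_le_lintegral_enorm _).trans h3) _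

variable (E F) in
-- Let `z₁` maximise `(r - |y - z|) ^ (d / σ) |f(y)|` over the closed ball. Near `z₁`, `|f|` is at
-- most a constant times `a = |f(z₁)|`, so in the mean value estimate at `z₁` one may replace `|f|`
-- by a constant times `a ^ (1 - σ) |f| ^ σ`. This bounds `a ^ σ`, and maximality transfers the
-- bound to `z`.
lemma exists_enorm_rpow_le_setLIntegral_ball_of_le_one [Nontrivial E] {σ : ℝ} (hσ : 0 < σ)
    (hσ1 : σ ≤ 1) : ∃ C : ℝ≥0, ∀ (f : E → F) (z : E) (R r : ℝ), 0 < r →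
    r < R → HarmonicOnNhd f (ball z R) → ‖f z‖ₑ ^ σ ≤
      C * ENNReal.ofReal (r ^ Module.finrank ℝ E)⁻¹ * ∫⁻ y in ball z r, ‖f y‖ₑ ^ σ := by
  obtain ⟨C, hC⟩ := exists_enorm_le_setLIntegral_ball E F
  set d := Module.finrank ℝ E with hd
  have hd0 : 0 < d := Module.finrank_pos
  -- With `κ σ = d`, comparing the values at `z` and `z₁` yields the factor `(2δ / r) ^ d`, which
  -- cancels the `δ ^ (-d)` of the mean value estimate at `z₁`.
  set κ : ℝ := d / σ with hκ
  have hκ0 : 0 < κ := by positivity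
  refine ⟨C * Real.toNNReal (2 ^ d * (2 ^ κ) ^ (1 - σ)), fun f z R r hr hrR hf => ?_⟩
  have hcont : ContinuousOn (fun y => (r - dist y z) ^ κ * ‖f y‖) (closedBall z r) := by
    refine ContinuousOn.mul ?_ (hf.continuousOn.mono (closedBall_subset_ball hrR)).norm
    exact ContinuousOn.rpow_const (by fun_prop) fun _ _ => Or.inr hκ0.le
  obtain ⟨z₁, hz₁, hmax⟩ := (isCompact_closedBall z r).exists_isMaxOn
    ⟨z, mem_closedBall_self hr.le⟩ hcont
  have hmax' : ∀ y ∈ closedBall z r,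
      (r - dist y z) ^ κ * ‖f y‖ ≤ (r - dist z₁ z) ^ κ * ‖f z₁‖ := fun y hy => hmax hy
  have hz := hmax' z (mem_closedBall_self hr.le)
  rw [dist_self, sub_zero] at hz
  rw [mem_closedBall] at hz₁
  obtain ⟨δ, hδ⟩ : ∃ δ, δ = (r - dist z₁ z) / 2 := ⟨_, rfl⟩
  have hδ2 : r - dist z₁ z = 2 * δ := by linarith
  rw [hδ2] at hz
  have hrκ : 0 < r ^ κ := by positivity
  -- If the maximum is zero, whether because `z₁` is on the sphere or because `f z₁ = 0`, then `f z
  -- = 0`.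
  rcases (show 0 ≤ δ by linarith).eq_or_lt with h0 | hδ0
  · rw [← h0, mul_zero, Real.zero_rpow hκ0.ne', zero_mul] at hz
    have : ‖f z‖ = 0 := le_antisymm (by nlinarith) (norm_nonneg _)
    rw [norm_eq_zero] at this
    simp [this, hσ]
  rcases (norm_nonneg (f z₁)).eq_or_lt with h0 | ha
  · rw [← h0, mul_zero] at hz
    have : ‖f z‖ = 0 := le_antisymm (by nlinarith) (norm_nonneg _)
    rw [norm_eq_zero] at this
    simp [this, hσ]
  set a := ‖f z₁‖ with ha_def
  have hsub2 : ball z₁ (2 * δ) ⊆ ball z r := ball_subset_ball' (by linarith)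
  have hsub : ball z₁ δ ⊆ ball z r := ball_subset_ball' (by linarith)
  have hbound : ∀ y ∈ ball z₁ δ, ‖f y‖ₑ ≤ ENNReal.ofReal (2 ^ κ * a) := by
    intro y hy
    rw [← ofReal_norm]
    refine ENNReal.ofReal_le_ofReal ?_
    have h1 := hmax' y (ball_subset_closedBall (hsub hy))
    rw [hδ2, Real.mul_rpow (by norm_num) hδ0.le] at h1
    have h2 : δ ≤ r - dist y z := by
      have := dist_triangle y z₁ z
      rw [mem_ball] at hy
      linarith
    have h3 : δ ^ κ ≤ (r - dist y z) ^ κ := Real.rpow_le_rpow hδ0.le h2 hκ0.le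
    have h4 : 0 < δ ^ κ := by positivity
    have h5 : δ ^ κ * ‖f y‖ ≤ δ ^ κ * (2 ^ κ * a) := by
      nlinarith [norm_nonneg (f y)]
    exact le_of_mul_le_mul_left h5 h4
  have hI : ∫⁻ y in ball z₁ δ, ‖f y‖ₑ ≤
      ENNReal.ofReal ((2 ^ κ * a) ^ (1 - σ)) * ∫⁻ y in ball z r, ‖f y‖ₑ ^ σ := by
    calc ∫⁻ y in ball z₁ δ, ‖f y‖ₑ
        ≤ ∫⁻ y in ball z₁ δ, ENNReal.ofReal ((2 ^ κ * a) ^ (1 - σ)) * ‖f y‖ₑ ^ σ := by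
          refine setLIntegral_mono' measurableSet_ball fun y hy => ?_
          calc ‖f y‖ₑ = ‖f y‖ₑ ^ (1 - σ) * ‖f y‖ₑ ^ σ := by
                rw [← ENNReal.rpow_add_of_nonneg _ _ (by linarith) hσ.le]
                simp
            _ ≤ _ := by
                rw [← ENNReal.ofReal_rpow_of_nonneg (by positivity) (by linarith)]
                gcongr
                exact hbound y hy
      _ = ENNReal.ofReal ((2 ^ κ * a) ^ (1 - σ)) * ∫⁻ y in ball z₁ δ, ‖f y‖ₑ ^ σ :=
          lintegral_const_mul' _ _ ENNReal.ofReal_ne_top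
      _ ≤ _ := by
          gcongr
  have h1 := hC f z₁ (2 * δ) δ hδ0 (by linarith)
    (hf.mono (hsub2.trans (ball_subset_ball hrR.le)))
  have hfz : ‖f z‖ ^ σ ≤ (2 * δ) ^ d * (r ^ d)⁻¹ * (a * a ^ (σ - 1)) := by
    have h2 := Real.rpow_le_rpow (by positivity) hz hσ.le
    have e : κ * σ = d := by rw [hκ]; field_simp
    rw [Real.mul_rpow (by positivity) (norm_nonneg _), Real.mul_rpow (by positivity) ha.le,
      ← Real.rpow_mul hr.le, ← Real.rpow_mul (by positivity), e, Real.rpow_natCast,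
      Real.rpow_natCast] at h2
    have h3 : a * a ^ (σ - 1) = a ^ σ := by
      rw [← Real.rpow_one_add' ha.le (by linarith)]
      congr 1
      ring
    rw [h3, mul_right_comm, ← div_eq_mul_inv, le_div_iff₀ (by positivity)]
    linarith
  have e1 : (2 * δ) ^ d * (r ^ d)⁻¹ * (a ^ (σ - 1) * ((δ ^ d)⁻¹ * (2 ^ κ * a) ^ (1 - σ))) =
      2 ^ d * (2 ^ κ) ^ (1 - σ) * (r ^ d)⁻¹ := by
    have h2 : a ^ (σ - 1) * a ^ (1 - σ) = 1 := by
      rw [← Real.rpow_add ha]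
      simp
    rw [Real.mul_rpow (by positivity) ha.le, mul_pow]
    have : δ ^ d ≠ 0 := by positivity
    calc _ = 2 ^ d * (2 ^ κ) ^ (1 - σ) * (r ^ d)⁻¹ * (a ^ (σ - 1) * a ^ (1 - σ)) *
          (δ ^ d * (δ ^ d)⁻¹) := by ring
      _ = _ := by rw [h2, mul_inv_cancel₀ this]; ring
  calc ‖f z‖ₑ ^ σ = ENNReal.ofReal (‖f z‖ ^ σ) := by
        rw [← ofReal_norm, ENNReal.ofReal_rpow_of_nonneg (norm_nonneg _) hσ.le]
    _ ≤ ENNReal.ofReal ((2 * δ) ^ d * (r ^ d)⁻¹ * (a * a ^ (σ - 1))) :=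
        ENNReal.ofReal_le_ofReal hfz
    _ = ENNReal.ofReal ((2 * δ) ^ d * (r ^ d)⁻¹) * ENNReal.ofReal (a ^ (σ - 1)) * ‖f z₁‖ₑ := by
        rw [← ofReal_norm, ← ENNReal.ofReal_mul (by positivity), ← ENNReal.ofReal_mul
          (by positivity)]
        congr 1
        ring
    _ ≤ ENNReal.ofReal ((2 * δ) ^ d * (r ^ d)⁻¹) * ENNReal.ofReal (a ^ (σ - 1)) *
        (C * ENNReal.ofReal (δ ^ d)⁻¹ * (ENNReal.ofReal ((2 ^ κ * a) ^ (1 - σ)) *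
          ∫⁻ y in ball z r, ‖f y‖ₑ ^ σ)) := by
        gcongr
        exact h1.trans (by gcongr)
    _ = C * ENNReal.ofReal ((2 * δ) ^ d * (r ^ d)⁻¹ *
        (a ^ (σ - 1) * ((δ ^ d)⁻¹ * (2 ^ κ * a) ^ (1 - σ)))) *
          ∫⁻ y in ball z r, ‖f y‖ₑ ^ σ := by
        rw [ENNReal.ofReal_mul (p := (2 * δ) ^ d * (r ^ d)⁻¹) (by positivity),
          ENNReal.ofReal_mul (p := a ^ (σ - 1)) (by positivity),
          ENNReal.ofReal_mul (p := (δ ^ d)⁻¹) (by positivity)]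
        ring
    _ = _ := by
        rw [e1, ENNReal.ofReal_mul (by positivity), ENNReal.coe_mul, ENNReal.ofReal]
        ring

variable (E F) in
/-- Sub-mean value property of `‖f‖ ^ σ` for a harmonic function `f` and any `σ > 0`. -/
theorem exists_enorm_rpow_le_setLIntegral_ball [Nontrivial E] {σ : ℝ} (hσ : 0 < σ) :
    ∃ C : ℝ≥0, ∀ (f : E → F) (z : E) (R r : ℝ), 0 < r →
    r < R → HarmonicOnNhd f (ball z R) → ‖f z‖ₑ ^ σ ≤
      C * ENNReal.ofReal (r ^ Module.finrank ℝ E)⁻¹ * ∫⁻ y in ball z r, ‖f y‖ₑ ^ σ := by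
  rcases le_total σ 1 with h1 | h1
  · exact exists_enorm_rpow_le_setLIntegral_ball_of_le_one E F hσ h1
  obtain ⟨C, hC⟩ := exists_enorm_le_setLIntegral_ball E F
  set d := Module.finrank ℝ E with hd
  set ω := volume (ball (0 : E) 1) with hω
  have hωt : ω ≠ ∞ := measure_ball_lt_top.ne
  refine ⟨C ^ σ * (ω ^ (σ - 1)).toNNReal, fun f z R r hr hrR hf => ?_⟩
  have hm : AEStronglyMeasurable f (volume.restrict (ball z r)) :=
    (hf.continuousOn.mono (ball_subset_ball hrR.le)).aestronglyMeasurable measurableSet_ball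
  -- For `σ ≥ 1`, Hölder on the ball turns the estimate for exponent `1` into the one for `σ`.
  have h2 := eLpNorm'_le_eLpNorm'_mul_rpow_measure_univ zero_lt_one h1 hm
  simp only [eLpNorm', ENNReal.rpow_one, div_one, Measure.restrict_apply_univ] at h2
  rw [Measure.addHaar_ball_of_pos _ _ hr, ← hω, ← hd] at h2
  set X := ENNReal.ofReal (r ^ d) with hX
  have hX0 : X ≠ 0 := by
    rw [hX, ENNReal.ofReal_ne_zero_iff]
    positivity
  have hXt : X ≠ ∞ := ENNReal.ofReal_ne_top
  have h3 := hC f z R r hr hrR hf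
  rw [ENNReal.ofReal_inv_of_pos (by positivity), ← hX] at h3 ⊢
  calc ‖f z‖ₑ ^ σ ≤ (C * X⁻¹ * ((∫⁻ y in ball z r, ‖f y‖ₑ ^ σ) ^ (1 / σ) *
        (X * ω) ^ (1 - 1 / σ))) ^ σ := by
        gcongr
        exact h3.trans (by gcongr)
    _ = (C : ℝ≥0∞) ^ σ * ω ^ (σ - 1) * (X⁻¹ ^ σ * X ^ (σ - 1)) *
        ∫⁻ y in ball z r, ‖f y‖ₑ ^ σ := by
        have e : (1 - 1 / σ) * σ = σ - 1 := by field_simp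
        rw [ENNReal.mul_rpow_of_nonneg _ _ hσ.le, ENNReal.mul_rpow_of_nonneg _ _ hσ.le,
          ENNReal.mul_rpow_of_nonneg _ _ hσ.le, ← ENNReal.rpow_mul, ← ENNReal.rpow_mul,
          one_div_mul_cancel hσ.ne', ENNReal.rpow_one, e,
          ENNReal.mul_rpow_of_nonneg _ _ (by linarith : 0 ≤ σ - 1)]
        ring
    _ = _ := by
        have e : X⁻¹ ^ σ * X ^ (σ - 1) = X⁻¹ := by
          rw [ENNReal.inv_rpow, ← ENNReal.rpow_neg, ← ENNReal.rpow_add _ _ hX0 hXt,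
            ← ENNReal.rpow_neg_one]
          congr 1
          ring
        rw [e, ENNReal.coe_mul, ENNReal.coe_toNNReal (ENNReal.rpow_ne_top_of_nonneg (by linarith)
          hωt), ENNReal.coe_rpow_of_nonneg _ hσ.le]

end SubMeanValue

/-! ### Geometry of Whitney cubes and of the boxes `Q_w` -/

section Geometry

variable {n : ℕ}

lemma abs_sub_apply_le_dist (z w : Space n) (i : Fin (n + 1)) : |z i - w i| ≤ dist z w := by
  rw [dist_eq_norm, ← Real.norm_eq_abs]
  exact PiLp.norm_apply_le (z - w) i

lemma isClosed_cube (c : Space n) (l : ℝ) : IsClosed (cube c l) := by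
  have : cube c l = ⋂ i, {z : Space n | |z i - c i| ≤ l / 2} := by
    ext z
    simp [cube]
  rw [this]
  exact isClosed_iInter fun i => isClosed_le (by fun_prop) continuous_const

lemma isOpen_upperHalfSpace : IsOpen (upperHalfSpace n) := by
  unfold upperHalfSpace height
  exact isOpen_lt continuous_const (by fun_prop)

lemma height_mem_of_mem_cube {c z : Space n} {l : ℝ} (hz : z ∈ cube c l) :
    height c - l / 2 ≤ height z ∧ height z ≤ height c + l / 2 := by
  have h := abs_le.1 (hz (Fin.last n))
  unfold height
  constructor <;> linarith

lemma self_mem_cube {c : Space n} {l : ℝ} (hl : 0 ≤ l) : c ∈ cube c l := fun i => by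
  rw [sub_self, abs_zero]
  positivity

lemma ball_subset_cube_enlarged {c z : Space n} {l : ℝ} (hl : 0 < l) (hz : z ∈ cube c l) :
    ball z (l / 64) ⊆ cube c (5 / 4 * l) := by
  intro w hw i
  have h1 := abs_sub_apply_le_dist w z i
  have h2 := hz i
  have h3 := abs_sub_le (w i) (z i) (c i)
  rw [mem_ball] at hw
  linarith

lemma ball_subset_boxAt {z w : Space n} (hw : dist w z ≤ height z / 8) :
    ball z (height z / 4) ⊆ boxAt w := by
  intro y hy i
  have h1 := abs_sub_apply_le_dist y w i
  have h2 := dist_triangle_right y w z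
  have h3 := abs_le.1 ((abs_sub_apply_le_dist w z (Fin.last n)).trans hw)
  rw [mem_ball] at hy
  have h4 : height w - height z = w (Fin.last n) - z (Fin.last n) := rfl
  linarith [h3.1, (dist_nonneg : 0 ≤ dist y z)]

lemma height_mem_of_mem_ball {z y : Space n} {r : ℝ} (hy : y ∈ ball z r) :
    height z - r ≤ height y ∧ height y ≤ height z + r := by
  have h := abs_le.1 ((abs_sub_apply_le_dist y z (Fin.last n)).trans (mem_ball.1 hy).le)
  unfold height
  constructor <;> linarith [h.1, h.2]

lemma ball_subset_upperHalfSpace (z : Space n) : ball z (height z) ⊆ upperHalfSpace n := by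
  intro y hy
  have h := abs_lt.1 ((abs_sub_apply_le_dist y z (Fin.last n)).trans_lt (mem_ball.1 hy))
  have h1 := h.1
  unfold height at h1
  change 0 < y (Fin.last n)
  linarith

/-- The side length of a Whitney cube is comparable with the height of its centre. -/
lemma IsWhitneyDecomposition.side_le_height {ζ : ℕ → Space n} {l : ℕ → ℝ}
    (h : IsWhitneyDecomposition ζ l) (k : ℕ) : 5 / 8 * l k ≤ height (ζ k) := by
  have hl := h.side_pos k
  -- This is the centre of the bottom face of `Δ_k*`, which still lies in the half space.
  have hmem : ζ k - EuclideanSpace.single (Fin.last n) (5 / 8 * l k) ∈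
      cube (ζ k) (5 / 4 * l k) := by
    intro i
    by_cases hi : i = Fin.last n
    · subst hi
      simp [abs_of_pos hl]
      linarith
    · simp only [PiLp.sub_apply, PiLp.single_apply, hi, if_false]
      rw [sub_zero, sub_self, abs_zero]
      positivity
  have h1 := h.enlarged_subset k hmem
  simp only [upperHalfSpace, height, Set.mem_ofPred_eq, PiLp.sub_apply] at h1
  simp at h1
  exact h1.le

lemma IsWhitneyDecomposition.exists_height_le_side {ζ : ℕ → Space n} {l : ℕ → ℝ}
    (h : IsWhitneyDecomposition ζ l) : ∃ B : ℝ, 0 < B ∧ ∀ k, height (ζ k) ≤ B * l k := by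
  obtain ⟨a, b, -, hb, hab⟩ := h.diam_dist
  -- The diameter is at most `(n + 1) l k`, and the centre lies `l k / 2` above the bottom face.
  refine ⟨b * (n + 1) + 1 / 2, by positivity, fun k => ?_⟩
  have hl := h.side_pos k
  have h1 := (hab k).2
  have h2 : diam (cube (ζ k) (l k)) ≤ (n + 1) * l k :=
    diam_le_of_forall_dist_le (by positivity) fun z hz w hw => dist_le_of_mem_cube hz hw
  have h3 : height (ζ k) - l k / 2 ≤
      setDist (cube (ζ k) (l k)) (frontier (upperHalfSpace n)) := by
    rw [frontier_upperHalfSpace]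
    refine le_csInf ⟨_, ζ k, self_mem_cube hl.le, 0, by simp [height], rfl⟩ ?_
    rintro _ ⟨z, hz, w, hw, rfl⟩
    have h4 := abs_sub_apply_le_dist z w (Fin.last n)
    have h5 : w (Fin.last n) = 0 := hw
    rw [h5, sub_zero] at h4
    exact (height_mem_of_mem_cube hz).1.trans ((le_abs_self _).trans h4)
  nlinarith

end Geometry

/-! ### Comparing powers of the height -/

section Weights

/-- The minimum and maximum cover both signs of `s`, for which `t ↦ t ^ s` has opposite
monotonicity. -/
lemma rpow_mem_Icc_of_mem_Icc {a b t h : ℝ} (ha : 0 < a) (hh : 0 < h) (h1 : a * h ≤ t)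
    (h2 : t ≤ b * h) (s : ℝ) :
    min (a ^ s) (b ^ s) * h ^ s ≤ t ^ s ∧ t ^ s ≤ max (a ^ s) (b ^ s) * h ^ s := by
  have ht : t = t / h * h := by field_simp
  have hu1 : a ≤ t / h := (le_div_iff₀ hh).2 h1
  have hu2 : t / h ≤ b := (div_le_iff₀ hh).2 h2
  generalize t / h = u at *
  have hu : 0 < u := ha.trans_le hu1
  subst ht
  rw [Real.mul_rpow hu.le hh.le]
  have hhs : 0 ≤ h ^ s := by positivity
  rcases le_total 0 s with hs | hs
  · have e1 := Real.rpow_le_rpow ha.le hu1 hs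
    have e2 := Real.rpow_le_rpow hu.le hu2 hs
    exact ⟨mul_le_mul_of_nonneg_right ((min_le_left _ _).trans e1) hhs,
      mul_le_mul_of_nonneg_right (e2.trans (le_max_right _ _)) hhs⟩
  · have e1 := Real.rpow_le_rpow_of_nonpos ha hu1 hs
    have e2 := Real.rpow_le_rpow_of_nonpos hu hu2 hs
    exact ⟨mul_le_mul_of_nonneg_right ((min_le_right _ _).trans e2) hhs,
      mul_le_mul_of_nonneg_right (e1.trans (le_max_left _ _)) hhs⟩

variable {n : ℕ}

lemma restrict_weightedMeasure {B : Set (Space n)} (hB : MeasurableSet B)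
    (hBH : B ⊆ upperHalfSpace n) (a : ℝ) : (weightedMeasure n a).restrict B =
      (volume.restrict B).withDensity fun z => ENNReal.ofReal (height z ^ a) := by
  rw [weightedMeasure, restrict_withDensity hB, Measure.restrict_restrict hB,
    Set.inter_eq_left.2 hBH]

/-- The measures are compared rather than the integrands, so `g` may be arbitrary. -/
lemma mul_setLIntegral_le_weightedMeasure {B Q : Set (Space n)} (hB : MeasurableSet B)
    (hBH : B ⊆ upperHalfSpace n) (hBQ : B ⊆ Q) {a c : ℝ} (hc : ∀ z ∈ B, c ≤ height z ^ a)
    (g : Space n → ℝ≥0∞) :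
    ENNReal.ofReal c * ∫⁻ z in B, g z ≤ ∫⁻ z in Q, g z ∂weightedMeasure n a := by
  refine le_trans ?_ (lintegral_mono_set hBQ)
  rw [restrict_weightedMeasure hB hBH, ← smul_eq_mul, ← lintegral_smul_measure]
  refine lintegral_mono' ?_ le_rfl
  rw [← withDensity_const]
  exact withDensity_mono (ae_restrict_of_forall_mem hB fun z hz =>
    ENNReal.ofReal_le_ofReal (hc z hz))

end Weights

/-! ### From the measure bound to the integral inequality -/

section Sufficiency

variable {n : ℕ} {F : Type*} [NormedAddCommGroup F] [NormedSpace ℝ F] [CompleteSpace F]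

variable (n F) in
-- The ball of radius `height z / 4` about `z` lies in `Q_w`, and on it the weight is comparable to
-- `height z ^ α`; the sub-mean value property on this ball gives the claim. That one constant
-- serves all nearby `w` allows averaging in `w` afterwards.
lemma exists_enorm_rpow_mul_le_setLIntegral_boxAt {σ : ℝ} (hσ : 0 < σ) (α : ℝ) :
    ∃ C : ℝ≥0, ∀ f : Space n → F, HarmonicOnNhd f (upperHalfSpace n) →
      ∀ z ∈ upperHalfSpace n, ∀ w, dist w z ≤ height z / 8 →
        ‖f z‖ₑ ^ σ * ENNReal.ofReal (height z ^ (n + 1 + α)) ≤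
          C * ∫⁻ y in boxAt w, ‖f y‖ₑ ^ σ ∂weightedMeasure n α := by
  obtain ⟨C, hC⟩ := exists_enorm_rpow_le_setLIntegral_ball (Space n) F hσ
  set c : ℝ := min ((3 / 4) ^ α) ((5 / 4) ^ α) with hc
  have hc0 : 0 < c := lt_min (by positivity) (by positivity)
  refine ⟨C * Real.toNNReal (4 ^ (n + 1) * c⁻¹), fun f hf z hz w hw => ?_⟩
  set h := height z with hh
  have h0 : 0 < h := hz
  have h1 := hC f z h (h / 4) (by positivity) (by linarith)
    (hf.mono (ball_subset_upperHalfSpace z))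
  have hfin : Module.finrank ℝ (Space n) = n + 1 := finrank_euclideanSpace_fin
  rw [hfin] at h1
  have h2 : ENNReal.ofReal (c * h ^ α) * ∫⁻ y in ball z (h / 4), ‖f y‖ₑ ^ σ ≤
      ∫⁻ y in boxAt w, ‖f y‖ₑ ^ σ ∂weightedMeasure n α := by
    refine mul_setLIntegral_le_weightedMeasure measurableSet_ball
      ((ball_subset_ball (by linarith)).trans (ball_subset_upperHalfSpace z))
      (ball_subset_boxAt hw) (fun y hy => ?_) _
    obtain ⟨g1, g2⟩ := height_mem_of_mem_ball hy
    exact (rpow_mem_Icc_of_mem_Icc (a := 3 / 4) (b := 5 / 4) (by norm_num) h0 (by linarith)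
      (by linarith) α).1
  have e : ((h / 4) ^ (n + 1))⁻¹ * h ^ (n + 1 + α) = 4 ^ (n + 1) * c⁻¹ * (c * h ^ α) := by
    rw [Real.rpow_add h0, ← Nat.cast_add_one, Real.rpow_natCast, div_pow]
    field_simp
  calc ‖f z‖ₑ ^ σ * ENNReal.ofReal (h ^ (n + 1 + α))
      ≤ (C * ENNReal.ofReal ((h / 4) ^ (n + 1))⁻¹ * ∫⁻ y in ball z (h / 4), ‖f y‖ₑ ^ σ) *
        ENNReal.ofReal (h ^ (n + 1 + α)) := by gcongr
    _ = C * ENNReal.ofReal (((h / 4) ^ (n + 1))⁻¹ * h ^ (n + 1 + α)) *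
        ∫⁻ y in ball z (h / 4), ‖f y‖ₑ ^ σ := by
        rw [ENNReal.ofReal_mul (by positivity)]
        ring
    _ = C * ENNReal.ofReal (4 ^ (n + 1) * c⁻¹) * (ENNReal.ofReal (c * h ^ α) *
        ∫⁻ y in ball z (h / 4), ‖f y‖ₑ ^ σ) := by
        rw [e, ENNReal.ofReal_mul (p := 4 ^ (n + 1) * c⁻¹) (by positivity)]
        ring
    _ ≤ _ := by
        rw [ENNReal.coe_mul]
        exact mul_le_mul_right h2 _

variable (F) in
lemma IsWhitneyDecomposition.exists_enorm_rpow_mul_le {ζ : ℕ → Space n} {l : ℕ → ℝ}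
    (h : IsWhitneyDecomposition ζ l) {p σ α : ℝ} (hp : 0 < p) (hσ : 0 < σ) (hα : -1 < α) :
    ∃ C : ℝ≥0, ∀ f : Space n → F, HarmonicOnNhd f (upperHalfSpace n) →
      ∀ k, ∀ z ∈ cube (ζ k) (l k),
        ‖f z‖ₑ ^ p * ENNReal.ofReal (height (ζ k) ^ (n + 1 + p * (n + 1 + α) / σ)) ≤
          C * ∫⁻ w in cube (ζ k) (5 / 4 * l k),
            (∫⁻ y in boxAt w, ‖f y‖ₑ ^ σ ∂weightedMeasure n α) ^ (p / σ) := by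
  obtain ⟨C, hC⟩ := exists_enorm_rpow_mul_le_setLIntegral_boxAt n F hσ α
  obtain ⟨B, hB0, hB⟩ := h.exists_height_le_side
  set ω := volume (ball (0 : Space n) 1) with hω
  have hωt : ω ≠ ∞ := measure_ball_lt_top.ne
  have hω0 : ω ≠ 0 := (measure_ball_pos _ _ one_pos).ne'
  have hq : 0 < p / σ := by positivity
  set e : ℝ := p * (n + 1 + α) / σ with he
  have he0 : 0 < e := by
    have : (0 : ℝ) ≤ n := by positivity
    have : 0 < (n + 1 + α : ℝ) := by linarith
    positivity
  -- From `η ≤ B l = 64 B (l / 64)` for the volume of the averaging ball and `η ≤ B l ≤ 8 B height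
  -- z` for the power of the height.
  set D : ℝ := (64 * B) ^ (n + 1) * (8 * B) ^ e with hD
  refine ⟨Real.toNNReal D * ω⁻¹.toNNReal * C ^ (p / σ), fun f hf k z hz => ?_⟩
  have hl := h.side_pos k
  have hs := h.side_le_height k
  have hBk := hB k
  set η := height (ζ k)
  have hη : 0 < η := by linarith
  have hzh : l k / 8 ≤ height z := by linarith [(height_mem_of_mem_cube hz).1]
  have hz0 : 0 < height z := by linarith
  set J : Space n → ℝ≥0∞ := fun w => ∫⁻ y in boxAt w, ‖f y‖ₑ ^ σ ∂weightedMeasure n α with hJ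
  -- The radius `l k / 64` is at most `height z / 8`, and the ball still fits into `Δ_k*`.
  have h1 : ∀ w ∈ ball z (l k / 64), ‖f z‖ₑ ^ p * ENNReal.ofReal (height z ^ e) ≤
      (C : ℝ≥0∞) ^ (p / σ) * J w ^ (p / σ) := by
    intro w hw
    have h2 := ENNReal.rpow_le_rpow
      (hC f hf z hz0 w ((mem_ball.1 hw).le.trans (by linarith))) hq.le
    rw [ENNReal.mul_rpow_of_nonneg _ _ hq.le, ENNReal.mul_rpow_of_nonneg _ _ hq.le,
      ← ENNReal.rpow_mul, ENNReal.ofReal_rpow_of_nonneg (by positivity) hq.le,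
      ← Real.rpow_mul hz0.le] at h2
    have e1 : σ * (p / σ) = p := by field_simp
    have e2 : (n + 1 + α) * (p / σ) = e := by rw [he]; ring
    rwa [e1, e2] at h2
  have h3 : ‖f z‖ₑ ^ p * ENNReal.ofReal (height z ^ e) *
      (ENNReal.ofReal ((l k / 64) ^ (n + 1)) * ω) ≤
        (C : ℝ≥0∞) ^ (p / σ) * ∫⁻ w in cube (ζ k) (5 / 4 * l k), J w ^ (p / σ) := by
    have hfin : Module.finrank ℝ (Space n) = n + 1 := finrank_euclideanSpace_fin
    calc _ = ∫⁻ w in ball z (l k / 64), ‖f z‖ₑ ^ p * ENNReal.ofReal (height z ^ e) := by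
          rw [setLIntegral_const, Measure.addHaar_ball_of_pos _ _ (by positivity), hfin]
      _ ≤ ∫⁻ w in ball z (l k / 64), (C : ℝ≥0∞) ^ (p / σ) * J w ^ (p / σ) :=
          setLIntegral_mono' measurableSet_ball h1
      _ = (C : ℝ≥0∞) ^ (p / σ) * ∫⁻ w in ball z (l k / 64), J w ^ (p / σ) :=
          lintegral_const_mul' _ _ (ENNReal.rpow_ne_top_of_nonneg hq.le ENNReal.coe_ne_top)
      _ ≤ _ := mul_le_mul_right (lintegral_mono_set (ball_subset_cube_enlarged hl hz)) _
  have h4 : η ^ (n + 1 + e) ≤ D * (height z ^ e * (l k / 64) ^ (n + 1)) := by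
    have e1 : η ^ (n + 1) ≤ (64 * B * (l k / 64)) ^ (n + 1) :=
      pow_le_pow_left₀ hη.le (by linarith) _
    have e2 : η ^ e ≤ (8 * B * height z) ^ e :=
      Real.rpow_le_rpow hη.le (by nlinarith) he0.le
    rw [mul_pow] at e1
    rw [Real.mul_rpow (by positivity) hz0.le] at e2
    rw [Real.rpow_add hη, ← Nat.cast_add_one, Real.rpow_natCast]
    calc _ ≤ _ := mul_le_mul e1 e2 (by positivity) (by positivity)
      _ = _ := by rw [hD]; ring
  calc ‖f z‖ₑ ^ p * ENNReal.ofReal (η ^ (n + 1 + e))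
      ≤ ‖f z‖ₑ ^ p * ENNReal.ofReal (D * (height z ^ e * (l k / 64) ^ (n + 1))) := by
        gcongr
    _ = ENNReal.ofReal D * (ω * ω⁻¹) * (‖f z‖ₑ ^ p * ENNReal.ofReal (height z ^ e) *
        ENNReal.ofReal ((l k / 64) ^ (n + 1))) := by
        rw [ENNReal.ofReal_mul (p := D) (by positivity),
          ENNReal.ofReal_mul (p := height z ^ e) (by positivity), ENNReal.mul_inv_cancel hω0 hωt]
        ring
    _ = ENNReal.ofReal D * ω⁻¹ * (‖f z‖ₑ ^ p * ENNReal.ofReal (height z ^ e) *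
        (ENNReal.ofReal ((l k / 64) ^ (n + 1)) * ω)) := by ring
    _ ≤ ENNReal.ofReal D * ω⁻¹ * ((C : ℝ≥0∞) ^ (p / σ) *
        ∫⁻ w in cube (ζ k) (5 / 4 * l k), J w ^ (p / σ)) := mul_le_mul_right h3 _
    _ = _ := by
        rw [ENNReal.coe_mul, ENNReal.coe_mul, ENNReal.coe_toNNReal (ENNReal.inv_ne_top.2 hω0),
          ENNReal.coe_rpow_of_nonneg _ hq.le, ENNReal.ofReal]
        ring

lemma IsWhitneyDecomposition.exists_tsum_setLIntegral_le {ζ : ℕ → Space n} {l : ℕ → ℝ}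
    (h : IsWhitneyDecomposition ζ l) : ∃ N : ℕ, ∀ g : Space n → ℝ≥0∞,
      ∑' k, ∫⁻ w in cube (ζ k) (5 / 4 * l k), g w ≤ N * ∫⁻ w in upperHalfSpace n, g w := by
  obtain ⟨N, hN⟩ := h.overlap
  refine ⟨N, fun g => ?_⟩
  rw [← lintegral_sum_measure]
  refine (lintegral_mono' (Measure.sum_restrict_le (M := N)
    (fun k => (isClosed_cube _ _).measurableSet) hN) le_rfl).trans ?_
  rw [lintegral_smul_measure, nsmul_eq_mul]
  exact mul_le_mul_right (lintegral_mono_set (Set.iUnion_subset h.enlarged_subset)) _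

lemma ENNReal.tsum_mul_le {ι : Type*} (a b : ι → ℝ≥0∞) :
    ∑' k, a k * b k ≤ (∑' k, a k) * ∑' k, b k := by
  rw [← ENNReal.tsum_mul_left]
  exact ENNReal.tsum_le_tsum fun k => mul_le_mul_left (ENNReal.le_tsum k) _

/-- Each factor is at most its own sum. Nonemptiness matters: empty products would sum to the
cardinality of `ι`. -/
lemma ENNReal.tsum_prod_le {ι κ : Type*} {s : Finset κ} (hs : s.Nonempty) (a : κ → ι → ℝ≥0∞) :
    ∑' k, ∏ i ∈ s, a i k ≤ ∏ i ∈ s, ∑' k, a i k := by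
  classical
  induction hs using Finset.Nonempty.cons_induction with
  | singleton i => simp
  | cons i s hi hs ih =>
    simp only [Finset.prod_cons]
    exact (ENNReal.tsum_mul_le _ _).trans (mul_le_mul_right ih _)

lemma prod_ofReal_rpow {m : ℕ} {η : ℝ} (hη : 0 < η) (e : Fin m → ℝ) :
    ∏ i, ENNReal.ofReal (η ^ (n + 1 + e i)) =
      ENNReal.ofReal (η ^ ((m : ℝ) * (n + 1) + ∑ i, e i)) := by
  rw [← ENNReal.ofReal_prod_of_nonneg fun i _ => by positivity, ← Real.rpow_sum_of_pos hη,
    Finset.sum_add_distrib, Finset.sum_const, Finset.card_univ, Fintype.card_fin, nsmul_eq_mul]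

theorem IsWhitneyDecomposition.lintegral_prod_le {m : ℕ} (hm : 1 ≤ m) {ζ : ℕ → Space n}
    {l : ℕ → ℝ} (h : IsWhitneyDecomposition ζ l) {p σ α : Fin m → ℝ} (hp : ∀ i, 0 < p i)
    (hσ : ∀ i, 0 < σ i) (hα : ∀ i, -1 < α i) {μ : Measure (upperHalfSpace n)} {C : ℝ≥0}
    (hC : ∀ k : ℕ, μ (Subtype.val ⁻¹' cube (ζ k) (l k)) ≤
      C * ENNReal.ofReal
        (height (ζ k) ^ ((m : ℝ) * (n + 1) + ∑ i, p i * (n + 1 + α i) / σ i))) :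
    ∃ C : ℝ≥0, ∀ f : Fin m → Space n → F,
      (∀ i, HarmonicOnNhd (f i) (upperHalfSpace n)) →
        ∫⁻ z : upperHalfSpace n, ∏ i, ‖f i z‖ₑ ^ p i ∂μ ≤
          C * ∏ i, ∫⁻ w in upperHalfSpace n,
            (∫⁻ z in boxAt w, ‖f i z‖ₑ ^ σ i ∂weightedMeasure n (α i)) ^ (p i / σ i) := by
  choose A hA using fun i => h.exists_enorm_rpow_mul_le F (hp i) (hσ i) (hα i)
  obtain ⟨N, hN⟩ := h.exists_tsum_setLIntegral_le
  -- This is where `1 ≤ m` enters: bounding a sum of products by a product of sums fails for the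
  -- empty product.
  have : Nonempty (Fin m) := ⟨⟨0, hm⟩⟩
  refine ⟨C * (∏ i, A i) * ∏ _i : Fin m, (N : ℝ≥0), fun f hf => ?_⟩
  set J : Fin m → Space n → ℝ≥0∞ := fun i w =>
    (∫⁻ z in boxAt w, ‖f i z‖ₑ ^ σ i ∂weightedMeasure n (α i)) ^ (p i / σ i) with hJ
  have hcover : (Set.univ : Set (upperHalfSpace n)) ⊆
      ⋃ k, Subtype.val ⁻¹' cube (ζ k) (l k) := by
    intro z _
    obtain ⟨k, hk⟩ := Set.mem_iUnion.1 (h.iUnion_eq.ge z.2)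
    exact Set.mem_iUnion.2 ⟨k, hk⟩
  have hk : ∀ k, ∫⁻ z in (Subtype.val ⁻¹' cube (ζ k) (l k) : Set (upperHalfSpace n)),
      ∏ i, ‖f i z‖ₑ ^ p i ∂μ ≤
        C * ((∏ i, (A i : ℝ≥0∞)) * ∏ i, ∫⁻ w in cube (ζ k) (5 / 4 * l k), J i w) := by
    intro k
    have hη : 0 < height (ζ k) := by linarith [h.side_le_height k, h.side_pos k]
    set X := ENNReal.ofReal
      (height (ζ k) ^ ((m : ℝ) * (n + 1) + ∑ i, p i * (n + 1 + α i) / σ i)) with hX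
    have hX0 : X ≠ 0 := by
      rw [hX, ENNReal.ofReal_ne_zero_iff]
      positivity
    have hXt : X ≠ ∞ := ENNReal.ofReal_ne_top
    set Y := (∏ i, (A i : ℝ≥0∞)) * ∏ i, ∫⁻ w in cube (ζ k) (5 / 4 * l k), J i w with hY
    have hpt : ∀ z ∈ (Subtype.val ⁻¹' cube (ζ k) (l k) : Set (upperHalfSpace n)),
        ∏ i, ‖f i z‖ₑ ^ p i ≤ Y / X := by
      intro z hz
      rw [ENNReal.le_div_iff_mul_le (Or.inl hX0) (Or.inl hXt), hX, ← prod_ofReal_rpow hη,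
        ← Finset.prod_mul_distrib, hY, ← Finset.prod_mul_distrib]
      exact Finset.prod_le_prod' fun i _ => hA i (f i) (hf i) k z hz
    calc _ ≤ ∫⁻ z in (Subtype.val ⁻¹' cube (ζ k) (l k) : Set (upperHalfSpace n)), Y / X ∂μ :=
          setLIntegral_mono' (measurable_subtype_coe (isClosed_cube _ _).measurableSet) hpt
      _ = Y / X * μ (Subtype.val ⁻¹' cube (ζ k) (l k)) := setLIntegral_const _ _
      _ ≤ Y / X * (C * X) := mul_le_mul_right (hC k) _
      _ = C * (Y / X * X) := by ring
      _ = C * Y := by rw [ENNReal.div_mul_cancel hX0 hXt]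
  calc ∫⁻ z : upperHalfSpace n, ∏ i, ‖f i z‖ₑ ^ p i ∂μ
      = ∫⁻ z in Set.univ, ∏ i, ‖f i z‖ₑ ^ p i ∂μ := by rw [Measure.restrict_univ]
    _ ≤ ∫⁻ z in ⋃ k, Subtype.val ⁻¹' cube (ζ k) (l k), ∏ i, ‖f i z‖ₑ ^ p i ∂μ :=
        lintegral_mono_set hcover
    _ ≤ ∑' k, ∫⁻ z in Subtype.val ⁻¹' cube (ζ k) (l k), ∏ i, ‖f i z‖ₑ ^ p i ∂μ :=
        lintegral_iUnion_le _ _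
    _ ≤ ∑' k, C * ((∏ i, (A i : ℝ≥0∞)) * ∏ i, ∫⁻ w in cube (ζ k) (5 / 4 * l k), J i w) :=
        ENNReal.tsum_le_tsum hk
    _ = C * (∏ i, (A i : ℝ≥0∞)) * ∑' k, ∏ i, ∫⁻ w in cube (ζ k) (5 / 4 * l k), J i w := by
        rw [ENNReal.tsum_mul_left, ENNReal.tsum_mul_left, mul_assoc]
    _ ≤ C * (∏ i, (A i : ℝ≥0∞)) * ∏ i, (N * ∫⁻ w in upperHalfSpace n, J i w) := by
        gcongr
        exact (ENNReal.tsum_prod_le Finset.univ_nonempty _).trans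
          (Finset.prod_le_prod' fun i _ => hN _)
    _ = _ := by
        rw [Finset.prod_mul_distrib, ENNReal.coe_mul, ENNReal.coe_mul, ENNReal.ofNNReal_finsetProd,
          ENNReal.ofNNReal_finsetProd, mul_assoc, mul_assoc, mul_assoc]
        simp [hJ]

end Sufficiency

/-! ### Test functions with a pole below the boundary -/

section TestFunction

variable {n : ℕ}

/-- The linear map `(x, t) ↦ t + i x₀`; its powers are harmonic polynomials if `n ≥ 1`. -/
noncomputable def heightAddI (n : ℕ) : Space n →L[ℝ] ℂ :=
  Complex.ofRealCLM.comp (EuclideanSpace.proj (Fin.last n)) +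
    Complex.I • Complex.ofRealCLM.comp (EuclideanSpace.proj 0)

lemma heightAddI_apply (z : Space n) :
    heightAddI n z = (z (Fin.last n) : ℂ) + Complex.I * (z 0 : ℂ) := rfl

lemma zero_ne_last_of_one_le (hn : 1 ≤ n) : (0 : Fin (n + 1)) ≠ Fin.last n := by
  rw [Ne, Fin.ext_iff, Fin.val_zero, Fin.val_last]
  omega

/-- Isotropy of the form: `1 ^ 2 + I ^ 2 = 0`, provided the axes `0` and `Fin.last n` differ, hence
`1 ≤ n`. -/
lemma sum_heightAddI_basisFun_sq (hn : 1 ≤ n) :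
    ∑ i, heightAddI n (EuclideanSpace.basisFun (Fin (n + 1)) ℝ i) ^ 2 = 0 := by
  have h0 := zero_ne_last_of_one_le hn
  have h : ∀ i, heightAddI n (EuclideanSpace.basisFun (Fin (n + 1)) ℝ i) ^ 2 =
      (if i = Fin.last n then 1 else 0) - (if i = 0 then 1 else 0) := by
    intro i
    rw [heightAddI_apply]
    by_cases h1 : i = Fin.last n
    · subst h1
      simp [h0, h0.symm]
    · by_cases h2 : i = 0
      · subst h2
        simp [h0, h0.symm]
      · simp [h1, h2, Ne.symm h1, Ne.symm h2]
  simp only [h, Finset.sum_sub_distrib, Finset.sum_ite_eq', Finset.mem_univ, if_true, sub_self]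

variable (𝕜 : Type*) [RCLike 𝕜]

/-- The test function with pole `c`, homogeneous of degree `-(k + n)` about `c`. -/
noncomputable def testFunction (k : ℕ) (c y : Space n) : 𝕜 :=
  ((kelvin (heightAddI n) k (k + (n + 1) / 2) c y).re : ℝ)

lemma harmonicOnNhd_testFunction (hn : 1 ≤ n) (k : ℕ) {c : Space n} (hc : height c ≤ 0) :
    HarmonicOnNhd (testFunction 𝕜 k c) (upperHalfSpace n) := by
  intro z hz
  have hzc : z ≠ c := by
    rintro rfl
    exact absurd hz (not_lt.2 hc)
  have h := harmonicAt_kelvin (EuclideanSpace.basisFun (Fin (n + 1)) ℝ) (heightAddI n)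
    (sum_heightAddI_basisFun_sq hn) k (β := k + (n + 1) / 2)
    (by rw [Fintype.card_fin]; push_cast; ring) hzc
  exact (h.comp_CLM Complex.reCLM).comp_CLM (RCLike.ofRealCLM (K := 𝕜))

lemma sq_rpow_neg_eq (k n : ℕ) {r : ℝ} (hr : 0 < r) :
    (r ^ 2) ^ (-((k : ℝ) + (n + 1) / 2)) = r ^ (-((k : ℝ) + n)) / r ^ (k + 1) := by
  rw [← Real.rpow_natCast, ← Real.rpow_natCast, ← Real.rpow_mul hr.le, ← Real.rpow_sub hr]
  congr 1
  push_cast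
  ring

lemma norm_testFunction_le (k : ℕ) {c y : Space n} (hy : y ≠ c) :
    ‖testFunction 𝕜 k c y‖ ≤
      ‖heightAddI n‖ ^ (k + 1) * ‖y - c‖ ^ (-((k : ℝ) + n)) := by
  have hr : 0 < ‖y - c‖ := norm_pos_iff.2 (sub_ne_zero.2 hy)
  rw [testFunction, RCLike.norm_ofReal]
  refine (Complex.abs_re_le_norm _).trans ?_
  rw [kelvin, norm_mul, norm_pow, Complex.norm_real, Real.norm_of_nonneg (by positivity),
    sq_rpow_neg_eq k n hr]
  calc _ ≤ (‖heightAddI n‖ * ‖y - c‖) ^ (k + 1) *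
        (‖y - c‖ ^ (-((k : ℝ) + n)) / ‖y - c‖ ^ (k + 1)) := by
        gcongr
        exact (heightAddI n).le_opNorm _
    _ = _ := by
        rw [mul_pow]
        field_simp

/-- The pole at depth `A * height ζ` below the boundary, under `ζ`. -/
noncomputable def pole (A : ℝ) (ζ : Space n) : Space n :=
  ζ - EuclideanSpace.single (Fin.last n) ((1 + A) * height ζ)

lemma height_pole (A : ℝ) (ζ : Space n) : height (pole A ζ) = -(A * height ζ) := by
  simp [pole, height]
  ring

/-- Factor out `a ^ k`: as `b / a → 0`, the real part of `(1 + i b / a) ^ k` tends to `1`, and `|b /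
a| ≤ 1 / A`. -/
lemma exists_half_le_re_pow (k : ℕ) : ∃ A : ℝ, 1 ≤ A ∧ ∀ a b h : ℝ, 0 < h → A * h ≤ a →
    |b| ≤ h → a ^ k / 2 ≤ (((a : ℂ) + Complex.I * b) ^ k).re := by
  have hc : Filter.Tendsto (fun u : ℝ => ((1 + Complex.I * (u : ℂ)) ^ k).re) (nhds 0)
      (nhds 1) := by
    have : Continuous fun u : ℝ => ((1 + Complex.I * (u : ℂ)) ^ k).re := by fun_prop
    simpa using this.tendsto 0
  obtain ⟨ε, hε, hball⟩ := Metric.eventually_nhds_iff.1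
    (hc.eventually (lt_mem_nhds (show (1 / 2 : ℝ) < 1 by norm_num)))
  refine ⟨max 1 (2 / ε), le_max_left _ _, fun a b h hh ha hb => ?_⟩
  have hA : 2 / ε * h ≤ a :=
    (mul_le_mul_of_nonneg_right (le_max_right _ _) hh.le).trans ha
  have ha0 : 0 < a := lt_of_lt_of_le (by positivity) hA
  have h1 : |b / a| < ε := by
    rw [abs_div, abs_of_pos ha0, div_lt_iff₀ ha0]
    have : 2 * h ≤ ε * a := by
      rw [div_mul_eq_mul_div, div_le_iff₀ hε] at hA
      linarith
    linarith
  have h2 := hball (y := b / a) (by rwa [Real.dist_eq, sub_zero])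
  have e : ((a : ℂ) + Complex.I * b) ^ k =
      ((a ^ k : ℝ) : ℂ) * (1 + Complex.I * ((b / a : ℝ) : ℂ)) ^ k := by
    have : (a : ℂ) ≠ 0 := by exact_mod_cast ha0.ne'
    push_cast
    rw [← mul_pow]
    congr 1
    field_simp
  rw [e, Complex.re_ofReal_mul]
  have : 0 < a ^ k := by positivity
  nlinarith

/-- Seen from the pole, points of the cube have height at least `A η` and horizontal coordinate `x₀`
at most `η` in absolute value, so the real part of the power does not cancel, while their distance
to the pole is at most a multiple of `η`. -/
lemma exists_le_norm_testFunction (hn : 1 ≤ n) (k : ℕ) : ∃ A c₀ : ℝ, 1 ≤ A ∧ 0 < c₀ ∧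
    ∀ (ζ : Space n) (l : ℝ), 0 < l → 5 / 8 * l ≤ height ζ → ∀ z ∈ cube ζ l,
      c₀ * height ζ ^ (-((k : ℝ) + n)) ≤ ‖testFunction 𝕜 k (pole A ζ) z‖ := by
  obtain ⟨A, hA1, hA⟩ := exists_half_le_re_pow (k + 1)
  -- The first summand bounds the distance to the centre, since `l ≤ 8 / 5 η`; the second is the
  -- distance from centre to pole, in units of `η`.
  set D : ℝ := 8 / 5 * (n + 1) + (1 + A) with hD
  have hD0 : 0 < D := by positivity
  set β : ℝ := k + (n + 1) / 2 with hβ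
  have hβ0 : 0 < β := by positivity
  refine ⟨A, 1 / 2 * (D ^ 2) ^ (-β), hA1, by positivity, fun ζ l hl hlη z hz => ?_⟩
  set η := height ζ with hη
  have hη0 : 0 < η := by linarith
  have hzh := height_mem_of_mem_cube hz
  have hval : heightAddI n (z - pole A ζ) =
      ((z (Fin.last n) + A * η : ℝ) : ℂ) + Complex.I *
        ((z 0 - pole A ζ 0 : ℝ) : ℂ) := by
    rw [heightAddI_apply]
    have : pole A ζ (Fin.last n) = -(A * η) := height_pole A ζ
    simp [this]
  have h0 := zero_ne_last_of_one_le hn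
  have hre : (η ^ (k + 1)) / 2 ≤ (heightAddI n (z - pole A ζ) ^ (k + 1)).re := by
    have hp0 : pole A ζ 0 = ζ 0 := by
      simp [pole, h0]
    have h1 : A * η ≤ z (Fin.last n) + A * η := by
      have : height z = z (Fin.last n) := rfl
      linarith [hzh.1]
    have h2 : |z 0 - pole A ζ 0| ≤ η := by
      rw [hp0]
      linarith [hz 0]
    rw [hval]
    refine le_trans ?_ (hA _ _ η hη0 h1 h2)
    gcongr
    nlinarith
  have hnorm : ‖z - pole A ζ‖ ≤ D * η := by
    have h1 := dist_le_of_mem_cube hz (self_mem_cube hl.le)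
    rw [dist_eq_norm] at h1
    have h2 : z - pole A ζ =
        (z - ζ) + EuclideanSpace.single (Fin.last n) ((1 + A) * η) := by
      rw [pole]
      abel
    rw [h2]
    refine (norm_add_le _ _).trans ?_
    rw [norm_single_axis, Real.norm_of_nonneg (by positivity)]
    have : (n + 1 : ℝ) * l ≤ (n + 1) * (8 / 5 * η) := by
      gcongr
      linarith
    rw [hD]
    linarith
  have hpos : 0 < ‖z - pole A ζ‖ := by
    rw [norm_pos_iff]
    intro h
    rw [h, map_zero, zero_pow (by omega), Complex.zero_re] at hre
    have : 0 < η ^ (k + 1) := by positivity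
    linarith
  have hpow : ((D * η) ^ 2) ^ (-β) ≤ (‖z - pole A ζ‖ ^ 2) ^ (-β) :=
    Real.rpow_le_rpow_of_nonpos (by positivity) (by gcongr) (by linarith)
  rw [testFunction, RCLike.norm_ofReal, kelvin, mul_comm (_ ^ (k + 1)), Complex.re_ofReal_mul]
  refine le_trans ?_ (le_abs_self _)
  calc 1 / 2 * (D ^ 2) ^ (-β) * η ^ (-((k : ℝ) + n))
      = ((D * η) ^ 2) ^ (-β) * (η ^ (k + 1) / 2) := by
        rw [mul_pow, Real.mul_rpow (by positivity) (by positivity), sq_rpow_neg_eq k n hη0]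
        field_simp
    _ ≤ _ := by gcongr

end TestFunction

/-! ### From the integral inequality to the measure bound -/

section Necessity

variable {n : ℕ}

lemma boxAt_subset_upperHalfSpace {w : Space n} (hw : w ∈ upperHalfSpace n) :
    boxAt w ⊆ upperHalfSpace n := by
  intro z hz
  have h := (height_mem_of_mem_cube hz).1
  have h0 : 0 < height w := hw
  change 0 < height z
  linarith

variable (n) in
lemma exists_weightedMeasure_boxAt_le (α : ℝ) : ∃ C : ℝ≥0, ∀ w ∈ upperHalfSpace n,
    weightedMeasure n α (boxAt w) ≤ C * ENNReal.ofReal (height w ^ (n + 1 + α)) := by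
  set ω := volume (ball (0 : Space n) 1) with hω
  have hωt : ω ≠ ∞ := measure_ball_lt_top.ne
  set c : ℝ := max ((1 / 2) ^ α) ((3 / 2) ^ α) with hc
  have hc0 : 0 < c := lt_max_of_lt_left (by positivity)
  refine ⟨Real.toNNReal (c * (n + 1) ^ (n + 1)) * ω.toNNReal, fun w hw => ?_⟩
  set s := height w with hs
  have hs0 : 0 < s := hw
  have hmeas : MeasurableSet (boxAt w) := (isClosed_cube _ _).measurableSet
  have hvol : volume (boxAt w) ≤ ENNReal.ofReal (((n + 1) * s) ^ (n + 1)) * ω := by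
    have hsub : boxAt w ⊆ closedBall w ((n + 1) * s) := fun z hz =>
      dist_le_of_mem_cube hz (self_mem_cube hs0.le)
    have hfin : Module.finrank ℝ (Space n) = n + 1 := finrank_euclideanSpace_fin
    refine (measure_mono hsub).trans ?_
    rw [Measure.addHaar_closedBall _ _ (by positivity), hfin]
  calc weightedMeasure n α (boxAt w)
      = ∫⁻ z in boxAt w, ENNReal.ofReal (height z ^ α) := by
        rw [← Measure.restrict_apply_univ, restrict_weightedMeasure hmeas
          (boxAt_subset_upperHalfSpace hw), withDensity_apply _ MeasurableSet.univ,
          Measure.restrict_univ]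
    _ ≤ ∫⁻ _ in boxAt w, ENNReal.ofReal (c * s ^ α) := by
        refine setLIntegral_mono' hmeas fun z hz => ENNReal.ofReal_le_ofReal ?_
        obtain ⟨h1, h2⟩ := height_mem_of_mem_cube hz
        exact (rpow_mem_Icc_of_mem_Icc (a := 1 / 2) (b := 3 / 2) (by norm_num) hs0
          (by linarith) (by linarith) α).2
    _ = ENNReal.ofReal (c * s ^ α) * volume (boxAt w) := setLIntegral_const _ _
    _ ≤ ENNReal.ofReal (c * s ^ α) * (ENNReal.ofReal (((n + 1) * s) ^ (n + 1)) * ω) := by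
        gcongr
    _ = ENNReal.ofReal (c * s ^ α * ((n + 1) * s) ^ (n + 1)) * ω := by
        rw [ENNReal.ofReal_mul (p := c * s ^ α) (by positivity)]
        ring
    _ = ENNReal.ofReal (c * (n + 1) ^ (n + 1) * s ^ (n + 1 + α)) * ω := by
        rw [Real.rpow_add hs0, ← Nat.cast_add_one, Real.rpow_natCast, mul_pow]
        ring_nf
    _ = _ := by
        rw [ENNReal.ofReal_mul (p := c * (n + 1) ^ (n + 1)) (by positivity), ENNReal.coe_mul,
          ENNReal.coe_toNNReal hωt, ENNReal.ofReal]
        ring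

lemma lintegral_one_add_norm_div_rpow (c : Space n) {η : ℝ} (hη : 0 < η) (L : ℝ) :
    ∫⁻ w : Space n, ENNReal.ofReal ((1 + ‖w - c‖ / η) ^ (-L)) =
      ENNReal.ofReal (η ^ (n + 1)) *
        ∫⁻ w : Space n, ENNReal.ofReal ((1 + ‖w‖) ^ (-L)) := by
  have h := lintegral_comp_add_smul
    (fun w : Space n => ENNReal.ofReal ((1 + ‖w - c‖ / η) ^ (-L))) c hη
  have hfin : Module.finrank ℝ (Space n) = n + 1 := finrank_euclideanSpace_fin
  have e : ∀ y : Space n, ‖c + η • y - c‖ / η = ‖y‖ := by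
    intro y
    rw [add_sub_cancel_left, norm_smul, Real.norm_of_nonneg hη.le]
    field_simp
  simp only [e, hfin] at h
  rw [h, ← mul_assoc, ← ENNReal.ofReal_mul (by positivity), mul_inv_cancel₀ (by positivity)]
  simp

/-- Points of `Q_w` have height at least `height w / 2` and `c` is not above the boundary, so
`height w ≤ 2 ‖y - c‖`, while `‖w - y‖ ≤ (n + 1) height w`. -/
lemma norm_sub_le_of_mem_boxAt {c w y : Space n} (hc : height c ≤ 0) (hw : w ∈ upperHalfSpace n)
    (hy : y ∈ boxAt w) : ‖w - c‖ ≤ (2 * n + 3) * ‖y - c‖ := by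
  have h0 : 0 < height w := hw
  have h1 := (height_mem_of_mem_cube hy).1
  have h2 := abs_sub_apply_le_dist y c (Fin.last n)
  have h3 := le_abs_self (y (Fin.last n) - c (Fin.last n))
  have h4 := dist_le_of_mem_cube (self_mem_cube h0.le) hy
  have h5 := dist_triangle w y c
  have e1 : y (Fin.last n) = height y := rfl
  have e2 : c (Fin.last n) = height c := rfl
  have h6 : height w ≤ 2 * dist y c := by linarith
  rw [← dist_eq_norm, ← dist_eq_norm]
  have h7 : (n + 1 : ℝ) * height w ≤ (n + 1) * (2 * dist y c) := by gcongr
  linarith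

/-- With `R = ‖w - c‖`, on `Q_w` the function is bounded by a multiple of `R ^ (-κ)`, and the mass
of `Q_w` by one of `R ^ (n + 1 + α)`. The outer integrand is thus at most a multiple of `R ^ (-L)`,
integrable away from the pole because `L > n + 1`; scaling by the depth of the pole gives the power.
-/
lemma exists_lintegral_le_of_norm_le {F : Type*} [NormedAddCommGroup F] {p σ α κ M : ℝ}
    (hp : 0 < p) (hσ : 0 < σ) (hα : -1 < α) (hκ : 0 ≤ κ) (hM : 0 ≤ M)
    (hL : (n + 1 : ℝ) < κ * p - p * (n + 1 + α) / σ) :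
    ∃ C : ℝ≥0, ∀ c : Space n, height c < 0 → ∀ g : Space n → F,
      (∀ y ∈ upperHalfSpace n, ‖g y‖ ≤ M * ‖y - c‖ ^ (-κ)) →
        ∫⁻ w in upperHalfSpace n,
          (∫⁻ z in boxAt w, ‖g z‖ₑ ^ σ ∂weightedMeasure n α) ^ (p / σ) ≤
            C * ENNReal.ofReal ((-height c) ^ (n + 1 + p * (n + 1 + α) / σ - κ * p)) := by
  obtain ⟨C, hC⟩ := exists_weightedMeasure_boxAt_le n α
  set L : ℝ := κ * p - p * (n + 1 + α) / σ with hLdef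
  have hfin : Module.finrank ℝ (Space n) = n + 1 := finrank_euclideanSpace_fin
  set I := ∫⁻ w : Space n, ENNReal.ofReal ((1 + ‖w‖) ^ (-L)) with hI
  have hIt : I ≠ ∞ := by
    refine (finite_integral_one_add_norm ?_).ne
    rw [hfin]
    push_cast
    exact hL
  have hq : 0 < p / σ := by positivity
  have hd : (0 : ℝ) < n + 1 + α := by
    have : (0 : ℝ) ≤ n := by positivity
    linarith
  set M' : ℝ := M * (2 * n + 3) ^ κ with hM'
  have hM'0 : 0 ≤ M' := by positivity
  refine ⟨C ^ (p / σ) * Real.toNNReal (M' ^ p * 2 ^ L) * I.toNNReal, fun c hc g hg => ?_⟩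
  set η := -height c with hη
  have hη0 : 0 < η := by linarith
  have hpt : ∀ w ∈ upperHalfSpace n,
      (∫⁻ z in boxAt w, ‖g z‖ₑ ^ σ ∂weightedMeasure n α) ^ (p / σ) ≤
        (C : ℝ≥0∞) ^ (p / σ) * ENNReal.ofReal (M' ^ p * 2 ^ L * η ^ (-L)) *
          ENNReal.ofReal ((1 + ‖w - c‖ / η) ^ (-L)) := by
    intro w hw
    set R := ‖w - c‖ with hR
    have hw0 : 0 < height w := hw
    have hRh : height w + η ≤ R := by
      have h1 := abs_sub_apply_le_dist w c (Fin.last n)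
      have h2 := le_abs_self (w (Fin.last n) - c (Fin.last n))
      have e1 : w (Fin.last n) = height w := rfl
      have e2 : c (Fin.last n) = height c := rfl
      rw [dist_eq_norm, ← hR] at h1
      linarith
    have hR0 : 0 < R := by linarith
    have hsup : ∀ z ∈ boxAt w, ‖g z‖ₑ ^ σ ≤ ENNReal.ofReal ((M' * R ^ (-κ)) ^ σ) := by
      intro z hz
      rw [← ofReal_norm, ENNReal.ofReal_rpow_of_nonneg (norm_nonneg _) hσ.le]
      refine ENNReal.ofReal_le_ofReal (Real.rpow_le_rpow (norm_nonneg _) ?_ hσ.le)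
      refine (hg z (boxAt_subset_upperHalfSpace hw hz)).trans ?_
      have h1 := norm_sub_le_of_mem_boxAt hc.le hw hz
      rw [hM', mul_assoc]
      refine mul_le_mul_of_nonneg_left ?_ hM
      have h2 : R / (2 * n + 3) ≤ ‖z - c‖ := by
        rw [div_le_iff₀ (by positivity)]
        linarith
      refine (Real.rpow_le_rpow_of_nonpos (by positivity) h2 (by linarith)).trans_eq ?_
      rw [Real.div_rpow hR0.le (by positivity), Real.rpow_neg (by positivity : (0 : ℝ) ≤ 2 * n + 3),
        div_inv_eq_mul, mul_comm]
    have hin : ∫⁻ z in boxAt w, ‖g z‖ₑ ^ σ ∂weightedMeasure n α ≤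
        C * ENNReal.ofReal ((M' * R ^ (-κ)) ^ σ * R ^ (n + 1 + α)) := by
      calc _ ≤ ∫⁻ z in boxAt w, ENNReal.ofReal ((M' * R ^ (-κ)) ^ σ) ∂weightedMeasure n α :=
            setLIntegral_mono' (isClosed_cube _ _).measurableSet hsup
        _ = ENNReal.ofReal ((M' * R ^ (-κ)) ^ σ) * weightedMeasure n α (boxAt w) :=
            setLIntegral_const _ _
        _ ≤ ENNReal.ofReal ((M' * R ^ (-κ)) ^ σ) *
            (C * ENNReal.ofReal (R ^ (n + 1 + α))) := by
            gcongr
            refine (hC w hw).trans ?_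
            gcongr
            linarith
        _ = _ := by
            rw [ENNReal.ofReal_mul (p := (M' * R ^ (-κ)) ^ σ) (by positivity)]
            ring
    have e1 : ((M' * R ^ (-κ)) ^ σ * R ^ (n + 1 + α)) ^ (p / σ) = M' ^ p * R ^ (-L) := by
      rw [Real.mul_rpow (by positivity) (by positivity), ← Real.rpow_mul (by positivity),
        ← Real.rpow_mul hR0.le, mul_div_cancel₀ _ hσ.ne',
        Real.mul_rpow hM'0 (by positivity), ← Real.rpow_mul hR0.le, mul_assoc,
        ← Real.rpow_add hR0]
      congr 2
      rw [hLdef]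
      ring
    -- The pole has depth `η`, so `R ≥ η` and hence `R ≥ (η + R) / 2`.
    have e2 : R ^ (-L) ≤ 2 ^ L * η ^ (-L) * (1 + R / η) ^ (-L) := by
      have h1 : (η * (1 + R / η)) / 2 ≤ R := by
        have : η * (1 + R / η) = η + R := by field_simp
        linarith
      refine (Real.rpow_le_rpow_of_nonpos (by positivity) h1 (by linarith)).trans_eq ?_
      rw [Real.div_rpow (by positivity) (by norm_num), Real.mul_rpow hη0.le (by positivity),
        Real.rpow_neg (by norm_num : (0 : ℝ) ≤ 2), div_inv_eq_mul]
      ring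
    calc _ ≤ (C * ENNReal.ofReal ((M' * R ^ (-κ)) ^ σ * R ^ (n + 1 + α))) ^ (p / σ) := by
          gcongr
      _ = (C : ℝ≥0∞) ^ (p / σ) * ENNReal.ofReal (M' ^ p * R ^ (-L)) := by
          rw [ENNReal.mul_rpow_of_nonneg _ _ hq.le,
            ENNReal.ofReal_rpow_of_nonneg (by positivity) hq.le, e1]
      _ ≤ (C : ℝ≥0∞) ^ (p / σ) *
          ENNReal.ofReal (M' ^ p * (2 ^ L * η ^ (-L) * (1 + R / η) ^ (-L))) := by
          gcongr
      _ = _ := by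
          rw [mul_assoc ((C : ℝ≥0∞) ^ (p / σ)), ← ENNReal.ofReal_mul (by positivity)]
          congr 2
          ring
  have hct : (C : ℝ≥0∞) ^ (p / σ) * ENNReal.ofReal (M' ^ p * 2 ^ L * η ^ (-L)) ≠ ∞ :=
    ENNReal.mul_ne_top (ENNReal.rpow_ne_top_of_nonneg hq.le ENNReal.coe_ne_top)
      ENNReal.ofReal_ne_top
  have e3 : η ^ (n + 1 + p * (n + 1 + α) / σ - κ * p) = η ^ (-L) * η ^ (n + 1) := by
    rw [← Real.rpow_natCast, ← Real.rpow_add hη0]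
    congr 1
    rw [hLdef]
    push_cast
    ring
  calc _ ≤ ∫⁻ w in upperHalfSpace n,
        (C : ℝ≥0∞) ^ (p / σ) * ENNReal.ofReal (M' ^ p * 2 ^ L * η ^ (-L)) *
          ENNReal.ofReal ((1 + ‖w - c‖ / η) ^ (-L)) :=
        setLIntegral_mono' isOpen_upperHalfSpace.measurableSet hpt
    _ ≤ ∫⁻ w, (C : ℝ≥0∞) ^ (p / σ) * ENNReal.ofReal (M' ^ p * 2 ^ L * η ^ (-L)) *
          ENNReal.ofReal ((1 + ‖w - c‖ / η) ^ (-L)) := setLIntegral_le_lintegral _ _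
    _ = (C : ℝ≥0∞) ^ (p / σ) * ENNReal.ofReal (M' ^ p * 2 ^ L * η ^ (-L)) *
        (ENNReal.ofReal (η ^ (n + 1)) * I) := by
        rw [lintegral_const_mul' _ _ hct, lintegral_one_add_norm_div_rpow c hη0 L]
    _ = _ := by
        rw [e3, ENNReal.ofReal_mul (p := η ^ (-L)) (by positivity),
          ENNReal.ofReal_mul (p := M' ^ p * 2 ^ L) (by positivity), ENNReal.coe_mul,
          ENNReal.coe_mul, ENNReal.coe_toNNReal hIt, ENNReal.coe_rpow_of_nonneg _ hq.le,
          ENNReal.ofReal]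
        ring

end Necessity

theorem IsWhitneyDecomposition.exists_measure_cube_le {𝕜 : Type*} [RCLike 𝕜] {n m : ℕ}
    (hn : 1 ≤ n) {ζ : ℕ → Space n} {l : ℕ → ℝ} (hΔ : IsWhitneyDecomposition ζ l)
    {p σ α : Fin m → ℝ} (hp : ∀ i, 0 < p i) (hσ : ∀ i, 0 < σ i) (hα : ∀ i, -1 < α i)
    {μ : Measure (upperHalfSpace n)} {C : ℝ≥0}
    (hC : ∀ f : Fin m → Space n → 𝕜,
      (∀ i, HarmonicOnNhd (f i) (upperHalfSpace n)) →
        ∫⁻ z : upperHalfSpace n, ∏ i, ‖f i z‖ₑ ^ p i ∂μ ≤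
          C * ∏ i, ∫⁻ w in upperHalfSpace n,
            (∫⁻ z in boxAt w, ‖f i z‖ₑ ^ σ i ∂weightedMeasure n (α i)) ^ (p i / σ i)) :
    ∃ C : ℝ≥0, ∀ k : ℕ, μ (Subtype.val ⁻¹' cube (ζ k) (l k)) ≤
      C * ENNReal.ofReal
        (height (ζ k) ^ ((m : ℝ) * (n + 1) + ∑ i, p i * (n + 1 + α i) / σ i)) := by
  -- One degree of decay has to serve all `i` at once, since the same function fills every slot; the
  -- sum of the individual thresholds suffices.
  obtain ⟨j, hj⟩ : ∃ j : ℕ, ∀ i,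
      (n + 1 : ℝ) < (j + n) * p i - p i * (n + 1 + α i) / σ i := by
    choose N hN using fun i => exists_nat_gt (((n : ℝ) + 1 + p i * (n + 1 + α i) / σ i) / p i)
    refine ⟨∑ i, N i, fun i => ?_⟩
    have h1 : (N i : ℝ) ≤ (∑ i, N i : ℕ) := by
      exact_mod_cast Finset.single_le_sum (fun _ _ => Nat.zero_le _) (Finset.mem_univ i)
    have h2 := (div_lt_iff₀ (hp i)).1 (hN i)
    have h3 : (N i : ℝ) * p i ≤ ((∑ i, N i : ℕ) + n : ℝ) * p i := by
      have := hp i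
      have : (0 : ℝ) ≤ n := by positivity
      gcongr
      linarith
    linarith
  set κ : ℝ := (j : ℝ) + n with hκ
  have hκ0 : 0 ≤ κ := by positivity
  obtain ⟨A, c₀, hA, hc₀, hlow⟩ := exists_le_norm_testFunction 𝕜 hn j
  have hA0 : 0 < A := by linarith
  choose B hB using fun i => exists_lintegral_le_of_norm_le (n := n) (F := 𝕜)
    (M := ‖heightAddI n‖ ^ (j + 1)) (hp i) (hσ i) (hα i) hκ0 (by positivity) (hj i)
  let e : Fin m → ℝ := fun i => p i * (n + 1 + α i) / σ i
  let D : Fin m → ℝ := fun i => A ^ (n + 1 + e i - κ * p i) * c₀ ^ (-p i)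
  refine ⟨C * ∏ i, (B i * Real.toNNReal (D i)), fun k => ?_⟩
  have hl := hΔ.side_pos k
  have hs := hΔ.side_le_height k
  set η := height (ζ k) with hη
  have hη0 : 0 < η := by linarith
  have hpole : height (pole A (ζ k)) < 0 := by
    rw [height_pole, ← hη]
    have : 0 < A * η := by positivity
    linarith
  -- The lower bound for the product of the test functions on `Δ_k`. It also factors out of the
  -- right-hand side, and is cancelled at the end, being neither `0` nor `∞`.
  set P := ∏ i, ENNReal.ofReal ((c₀ * η ^ (-κ)) ^ p i) with hP
  have hP0 : P ≠ 0 := by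
    refine Finset.prod_ne_zero_iff.2 fun i _ => ?_
    rw [ENNReal.ofReal_ne_zero_iff]
    positivity
  have hPt : P ≠ ∞ := ENNReal.prod_ne_top fun i _ => ENNReal.ofReal_ne_top
  have hnorm : ∀ y ∈ upperHalfSpace n, ‖testFunction 𝕜 j (pole A (ζ k)) y‖ ≤
      ‖heightAddI n‖ ^ (j + 1) * ‖y - pole A (ζ k)‖ ^ (-κ) := by
    intro y hy
    refine norm_testFunction_le 𝕜 j ?_
    rintro rfl
    exact absurd hy (not_lt.2 hpole.le)
  have h1 := hC (fun _ => testFunction 𝕜 j (pole A (ζ k)))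
    fun _ => harmonicOnNhd_testFunction 𝕜 hn j hpole.le
  have h2 : P * μ (Subtype.val ⁻¹' cube (ζ k) (l k)) ≤
      ∫⁻ z : upperHalfSpace n, ∏ i, ‖testFunction 𝕜 j (pole A (ζ k)) z‖ₑ ^ p i ∂μ := by
    rw [← setLIntegral_const]
    refine (setLIntegral_mono' (measurable_subtype_coe (isClosed_cube _ _).measurableSet)
      fun z hz => ?_).trans (setLIntegral_le_lintegral _ _)
    refine Finset.prod_le_prod' fun i _ => ?_
    rw [← ofReal_norm, ENNReal.ofReal_rpow_of_nonneg (norm_nonneg _) (hp i).le]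
    exact ENNReal.ofReal_le_ofReal (Real.rpow_le_rpow (by positivity)
      (hlow (ζ k) (l k) hl hs z hz) (hp i).le)
  have h3 : ∀ i, ∫⁻ w in upperHalfSpace n,
      (∫⁻ z in boxAt w, ‖testFunction 𝕜 j (pole A (ζ k)) z‖ₑ ^ σ i
        ∂weightedMeasure n (α i)) ^ (p i / σ i) ≤
      B i * ENNReal.ofReal (D i) * ENNReal.ofReal (η ^ (n + 1 + e i)) *
        ENNReal.ofReal ((c₀ * η ^ (-κ)) ^ p i) := by
    intro i
    refine (hB i (pole A (ζ k)) hpole _ hnorm).trans_eq ?_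
    have hD0 : 0 ≤ D i := by positivity
    rw [height_pole, neg_neg, ← hη, mul_assoc, mul_assoc, ← ENNReal.ofReal_mul (by positivity),
      ← ENNReal.ofReal_mul hD0]
    congr 2
    have g1 : η ^ (n + 1 + e i - κ * p i) = η ^ (n + 1 + e i) * (η ^ (-κ)) ^ p i := by
      rw [← Real.rpow_mul hη0.le, ← Real.rpow_add hη0]
      congr 1
      ring
    have g2 : c₀ ^ (-p i) * c₀ ^ p i = 1 := by
      rw [← Real.rpow_add hc₀]
      simp
    change (A * η) ^ (n + 1 + e i - κ * p i) = _
    rw [Real.mul_rpow hA0.le hη0.le, g1, Real.mul_rpow hc₀.le (by positivity)]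
    calc _ = A ^ (n + 1 + e i - κ * p i) * (c₀ ^ (-p i) * c₀ ^ p i) *
          (η ^ (n + 1 + e i) * (η ^ (-κ)) ^ p i) := by rw [g2, mul_one]
      _ = _ := by
        simp only [D]
        ring
  have h4 : P * μ (Subtype.val ⁻¹' cube (ζ k) (l k)) ≤
      C * ((∏ i, (B i * ENNReal.ofReal (D i))) * ENNReal.ofReal
        (η ^ ((m : ℝ) * (n + 1) + ∑ i, e i)) * P) := by
    refine (h2.trans h1).trans (mul_le_mul_right ?_ _)
    rw [← prod_ofReal_rpow hη0, hP, ← Finset.prod_mul_distrib, ← Finset.prod_mul_distrib]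
    exact Finset.prod_le_prod' fun i _ => h3 i
  have h5 : μ (Subtype.val ⁻¹' cube (ζ k) (l k)) ≤
      C * (∏ i, (B i * ENNReal.ofReal (D i))) * ENNReal.ofReal
        (η ^ ((m : ℝ) * (n + 1) + ∑ i, e i)) := by
    refine (ENNReal.mul_le_mul_iff_right hP0 hPt).1 (h4.trans_eq ?_)
    ring
  refine h5.trans_eq ?_
  rw [ENNReal.coe_mul, ENNReal.ofNNReal_finsetProd]
  simp only [ENNReal.coe_mul, e]
  rfl

theorem theorem5 {𝕜 : Type*} [RCLike 𝕜] (n m : ℕ) (hn : 1 ≤ n) (hm : 1 ≤ m)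
    (ζ : ℕ → Space n) (l : ℕ → ℝ) (hΔ : IsWhitneyDecomposition ζ l)
    (p σ α : Fin m → ℝ) (hp : ∀ i, 0 < p i) (hσ : ∀ i, 0 < σ i) (hα : ∀ i, -1 < α i)
    (μ : Measure (upperHalfSpace n)) :
    (∃ C : ℝ≥0, ∀ f : Fin m → Space n → 𝕜,
      (∀ i, HarmonicOnNhd (f i) (upperHalfSpace n)) →
        ∫⁻ z : upperHalfSpace n, ∏ i, ‖f i z‖ₑ ^ p i ∂μ ≤
          C * ∏ i, ∫⁻ w in upperHalfSpace n,
            (∫⁻ z in boxAt w, ‖f i z‖ₑ ^ σ i ∂weightedMeasure n (α i)) ^ (p i / σ i)) ↔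
    (∃ C : ℝ≥0, ∀ k : ℕ,
      μ (Subtype.val ⁻¹' cube (ζ k) (l k)) ≤
        C * ENNReal.ofReal
          (height (ζ k) ^ ((m : ℝ) * (n + 1) + ∑ i, p i * (n + 1 + α i) / σ i))) :=
  ⟨fun ⟨_, hC⟩ => hΔ.exists_measure_cube_le hn hp hσ hα hC,
    fun ⟨_, hC⟩ => hΔ.lintegral_prod_le hm hp hσ hα hC⟩
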